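/- Let $\beta>0$ and let $U_\beta(t)$, $0\le t\le 1$, be the (stationary) Ornstein–Uhlenbeck process, i.e. a measurable zero-mean Gaussian process on $[0,1]$ with covariance $\mathbb{E}\,U_\beta(t)U_\beta(s)=\frac{1}{2\beta}\exp(-\beta|t-s|)$. Let $\overline{U_\beta}(t)=U_\beta(t)-\int_0^1U_\beta(s)\,ds$ be the demeaned process, and let $\|X\|=\big(\int_0^1 X(t)^2\,dt\big)^{1/2}$ denote the norm in $L_2[0,1]$. Then $$ \mathbb{P}\big\{\|\overline{U_\beta}\|\le\varepsilon\big\}\sim\Big(\frac{16\,e^{\beta}}{\pi(2+\beta)}\Big)^{1/2}\exp\Big(-\frac18\,\varepsilon^{-2}\Big),\qquad \varepsilon\to0^+, $$ that is, the ratio of the two sides tends to $1$. -/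

import Mathlib

open MeasureTheory ProbabilityTheory Filter Topology Asymptotics
open scoped unitInterval

/-- `U` is an Ornstein-Uhlenbeck process on `[0,1]` with parameter `β`: a (measurable) zero-mean
Gaussian process with `𝔼 U(t) U(s) = exp (-β |t - s|) / (2 β)`. The measurability requirement
is up to null sets of (Lebesgue measure on `[0,1]`) × `P`; it makes the integrals of the sample
paths meaningful, and holds in particular for every version with continuous paths. -/
structure IsOrnsteinUhlenbeck {Ω : Type*} [MeasurableSpace Ω] (β : ℝ) (U : I → Ω → ℝ)
    (P : Measure Ω) : Prop where
  isGaussianProcess : IsGaussianProcess U P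
  aemeasurable_uncurry :
    AEMeasurable (Function.uncurry U) ((volume : Measure I).prod P)
  mean_zero : ∀ t : I, ∫ ω, U t ω ∂P = 0
  covariance : ∀ t s : I,
    ∫ ω, U t ω * U s ω ∂P = 1 / (2 * β) * Real.exp (-β * |(t : ℝ) - (s : ℝ)|)

/-- The demeaned process `X(t) - ∫₀¹ X(s) ds`. -/
noncomputable def demeaned {Ω : Type*} (X : I → Ω → ℝ) : I → Ω → ℝ :=
  fun t ω => X t ω - ∫ s : I, X s ω

/-- The norm in `L₂[0,1]` of the sample path of `X` at `ω`, as an extended nonnegative real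
(it is `∞` when the path is not square integrable). -/
noncomputable def pathNorm {Ω : Type*} (X : I → Ω → ℝ) (ω : Ω) : ENNReal :=
  eLpNorm (fun t : I => X t ω) 2 volume

/-!
Almost surely `‖demeaned U‖² = S`, the variance of the sample path over `[0, 1]`. Sampling the path
on a grid of mesh `1 / n` replaces `S` by a quadratic form in a Gaussian vector, so the Laplace
transform of `S` is a limit of inverse square roots of `det (1 + c • C * R)`, where `C` is the
centering matrix and `R` has entries `ρ ^ |i - j|`. The determinants of `1 + c • R` solve a two-term
recursion, `C` is a rank one perturbation of the identity, and in the limit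
`𝔼 exp (-z S) = D (√(2 z + β²)) ^ (-1 / 2)` with an explicit `D`, at first for real `z > 0` and then
for `Re z > 0` by analytic continuation.

Since `D (√(2 z + β²))` is asymptotic to `(2 + β) exp (√(2 z) - β) / (4 √(2 z))`,
`𝔼 exp (-z S) ~ A (2 z) ^ (1 / 4) exp (-√(2 z) / 2)` with `A² = 4 exp β / (2 + β)`. Integrating
this against `exp (z x) / z` over the vertical line through the saddle point `√(2 z) = 1 / (2 x)`
of `z x - √(2 z) / 2` gives `P (S ≤ x) ~ 2 A / √π * exp (-1 / (8 x))`, and the claim is the case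
`x = ε²`.
-/

section BromwichInversion

lemma ofReal_exp_cpow (x : ℝ) (s : ℂ) : (Real.exp x : ℂ) ^ s = Complex.exp (s * x) := by
  rw [Complex.cpow_def_of_ne_zero (Complex.ofReal_ne_zero.2 (Real.exp_pos x).ne'),
    ← Complex.ofReal_log (Real.exp_pos x).le, Real.log_exp, mul_comm]

lemma hasMellin_indicator_Ioc {a : ℝ} (ha : 0 < a) {s : ℂ} (hs : 0 < s.re) :
    HasMellin (Set.indicator (Set.Ioc 0 a) fun _ => (1 : ℂ)) s ((a : ℂ) ^ s / s) := by
  have hscale : Set.indicator (Set.Ioc 0 a) (fun _ => (1 : ℂ)) =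
      fun u => Set.indicator (Set.Ioc 0 1) (fun _ => (1 : ℂ)) (a⁻¹ * u) := by
    ext u
    simp only [Set.indicator, Set.mem_Ioc, inv_mul_le_one₀ ha, inv_pos.2 ha,
      mul_pos_iff_of_pos_left]
  obtain ⟨hconv, hval⟩ := hasMellin_one_Ioc hs
  rw [hscale]
  refine ⟨(MellinConvergent.comp_mul_left (inv_pos.2 ha)).2 hconv, ?_⟩
  rw [mellin_comp_mul_left _ _ (inv_pos.2 ha), hval, smul_eq_mul, Complex.ofReal_inv,
    Complex.inv_cpow _ _ (by simp [Complex.arg_ofReal_of_nonneg ha.le, Real.pi_pos.ne]),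
    Complex.cpow_neg, inv_inv, mul_one_div]

lemma integrable_cpow_mul_indicator_le_exp_neg {μ : Measure ℝ} [IsFiniteMeasure μ]
    (hμ : ∀ᵐ x ∂μ, 0 ≤ x) {s : ℂ} (hs : 0 < s.re) :
    Integrable (fun q : ℝ × ℝ => (q.1 : ℂ) ^ (s - 1) *
        Set.indicator (Set.Ioc 0 (Real.exp (-q.2))) (fun _ => (1 : ℂ)) q.1)
      ((volume.restrict (Set.Ioi 0)).prod μ) := by
  have hdom : Integrable (fun u : ℝ => (u : ℂ) ^ (s - 1) *
      Set.indicator (Set.Ioc 0 1) (fun _ => (1 : ℂ)) u) (volume.restrict (Set.Ioi 0)) :=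
    (hasMellin_one_Ioc hs).1
  have hset : MeasurableSet {q : ℝ × ℝ | q.1 ∈ Set.Ioc 0 (Real.exp (-q.2))} :=
    (measurableSet_lt measurable_const measurable_fst).inter
      (measurableSet_le measurable_fst (by fun_prop))
  refine (hdom.comp_fst μ).mono ?_ ?_
  · exact ((by fun_prop : Measurable fun q : ℝ × ℝ => (q.1 : ℂ) ^ (s - 1)).mul
      (Measurable.ite hset measurable_const measurable_const)).aestronglyMeasurable
  · filter_upwards [Measure.quasiMeasurePreserving_snd.ae hμ] with q hq
    rw [norm_mul, norm_mul]
    gcongr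
    refine norm_indicator_le_of_subset (Set.Ioc_subset_Ioc_right ?_) _ _
    exact Real.exp_le_one_iff.2 (neg_nonpos.2 hq)

variable {μ : Measure ℝ} [IsProbabilityMeasure μ]

lemma integral_indicator_le_exp_neg {u : ℝ} (hu : 0 < u) :
    ∫ x, Set.indicator (Set.Ioc 0 (Real.exp (-x))) (fun _ => (1 : ℂ)) u ∂μ =
      cdf μ (-Real.log u) := by
  have hmem : ∀ x, u ∈ Set.Ioc 0 (Real.exp (-x)) ↔ x ∈ Set.Iic (-Real.log u) := fun x => by
    rw [Set.mem_Ioc, and_iff_right hu, ← Real.log_le_iff_le_exp hu, Set.mem_Iic, le_neg]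
  have hswap : ∀ x, Set.indicator (Set.Ioc 0 (Real.exp (-x))) (fun _ => (1 : ℂ)) u =
      Set.indicator (Set.Iic (-Real.log u)) (fun _ => (1 : ℂ)) x := fun x => by
    simp only [Set.indicator, hmem]
  simp_rw [hswap]
  rw [integral_indicator_const _ measurableSet_Iic, cdf_eq_real, Complex.real_smul, mul_one]

lemma hasMellin_cdf_neg_log (hμ : ∀ᵐ x ∂μ, 0 ≤ x) {s : ℂ} (hs : 0 < s.re) :
    HasMellin (fun u => (cdf μ (-Real.log u) : ℂ)) s (complexMGF id μ (-s) / s) := by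
  have hint := integrable_cpow_mul_indicator_le_exp_neg hμ hs
  have hinner : ∀ u ∈ Set.Ioi (0 : ℝ), ∫ x, (u : ℂ) ^ (s - 1) *
      Set.indicator (Set.Ioc 0 (Real.exp (-x))) (fun _ => (1 : ℂ)) u ∂μ =
        (u : ℂ) ^ (s - 1) • (cdf μ (-Real.log u) : ℂ) := fun u hu => by
    rw [integral_const_mul, integral_indicator_le_exp_neg hu, smul_eq_mul]
  constructor
  · exact (integrableOn_congr_fun hinner measurableSet_Ioi).1 hint.integral_prod_left
  · rw [mellin, ← setIntegral_congr_fun measurableSet_Ioi hinner, integral_integral_swap hint,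
      complexMGF, ← integral_div]
    congr 1 with x
    have hmellin := (hasMellin_indicator_Ioc (Real.exp_pos (-x)) hs).2
    simp only [mellin, smul_eq_mul] at hmellin
    rw [hmellin, ofReal_exp_cpow, Complex.ofReal_neg, mul_neg, neg_mul, id]

lemma continuous_bromwich {g : ℝ → ℂ} (hg : Integrable g) (c : ℝ) :
    Continuous fun x : ℝ => ∫ y : ℝ, Complex.exp ((c + y * Complex.I) * x) * g y := by
  have hsplit : ∀ x y : ℝ, Complex.exp ((c + y * Complex.I) * x) * g y =
      Complex.exp (c * x) * (Complex.exp ((y * x : ℝ) * Complex.I) * g y) := fun x y => by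
    rw [← mul_assoc, ← Complex.exp_add]
    push_cast
    ring_nf
  simp_rw [hsplit, integral_const_mul]
  refine (by fun_prop : Continuous fun x : ℝ => Complex.exp (c * x)).mul ?_
  refine continuous_of_dominated (bound := fun y => ‖g y‖) (fun x => ?_) (fun x => ?_) hg.norm
    (Eventually.of_forall fun y => by fun_prop)
  · exact (by fun_prop : Continuous fun y : ℝ => Complex.exp ((y * x : ℝ) * Complex.I)
      ).aestronglyMeasurable.mul hg.aestronglyMeasurable
  · refine Eventually.of_forall fun y => ?_
    rw [norm_mul, Complex.norm_exp_ofReal_mul_I, one_mul]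

lemma cdf_eq_bromwich_of_continuousAt (hμ : ∀ᵐ x ∂μ, 0 ≤ x) {c : ℝ} (hc : 0 < c)
    (hint : Integrable fun y : ℝ =>
      complexMGF id μ (-(c + y * Complex.I)) / (c + y * Complex.I))
    {x : ℝ} (hx : ContinuousAt (cdf μ) x) :
    (cdf μ x : ℂ) = (2 * Real.pi)⁻¹ * ∫ y : ℝ, Complex.exp ((c + y * Complex.I) * x) *
      (complexMGF id μ (-(c + y * Complex.I)) / (c + y * Complex.I)) := by
  have hre : ∀ y : ℝ, 0 < (c + y * Complex.I : ℂ).re := fun y => by simpa using hc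
  have hcont : ContinuousAt (fun u => (cdf μ (-Real.log u) : ℂ)) (Real.exp (-x)) := by
    refine Complex.continuous_ofReal.continuousAt.comp (ContinuousAt.comp ?_ ?_)
    · simpa using hx
    · exact (Real.continuousAt_log (Real.exp_pos _).ne').neg
  have hinv := mellinInv_mellin_eq c _ (Real.exp_pos (-x))
    (hasMellin_cdf_neg_log hμ (s := c) (by simpa using hc)).1
    (by simpa only [Complex.VerticalIntegrable, (hasMellin_cdf_neg_log hμ (hre _)).2] using hint)
    hcont
  rw [mellinInv, Real.log_exp, neg_neg] at hinv
  rw [← hinv, Complex.real_smul]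
  congr 1
  · push_cast
    rw [one_div]
  · congr 1 with y
    rw [(hasMellin_cdf_neg_log hμ (hre y)).2, ofReal_exp_cpow, smul_eq_mul]
    push_cast
    ring_nf

/-- `μ` may have atoms: the inversion formula holds at the continuity points of the distribution
function by Mellin inversion, and everywhere else by right continuity. -/
theorem cdf_eq_bromwich (hμ : ∀ᵐ x ∂μ, 0 ≤ x) {c : ℝ} (hc : 0 < c)
    (hint : Integrable fun y : ℝ =>
      complexMGF id μ (-(c + y * Complex.I)) / (c + y * Complex.I)) (x : ℝ) :
    (cdf μ x : ℂ) = (2 * Real.pi)⁻¹ * ∫ y : ℝ, Complex.exp ((c + y * Complex.I) * x) *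
      (complexMGF id μ (-(c + y * Complex.I)) / (c + y * Complex.I)) := by
  have hfreq : ∃ᶠ t in 𝓝[>] x, ContinuousAt (cdf μ) t := by
    have hdense := (monotone_cdf μ).countable_not_continuousAt.dense_compl ℝ
    have hx : x ∈ closure (Set.Ioi x) := by rw [closure_Ioi]; exact Set.self_mem_Ici
    have hclosure := closure_minimal (hdense.open_subset_closure_inter isOpen_Ioi)
      isClosed_closure hx
    rw [mem_closure_iff_frequently] at hclosure
    exact frequently_nhdsWithin_iff.2
      (hclosure.mono fun t ht => ⟨not_not.1 ht.2, ht.1⟩)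
  refine tendsto_nhds_unique_of_frequently_eq
    ((Complex.continuous_ofReal.tendsto _).comp
      (((cdf μ).right_continuous x).mono_left (nhdsWithin_mono _ Set.Ioi_subset_Ici_self)))
    ((((continuous_bromwich hint c).const_mul _).tendsto x).mono_left nhdsWithin_le_nhds)
    (hfreq.mono fun t ht => cdf_eq_bromwich_of_continuousAt hμ hc hint ht)

end BromwichInversion

section ComplexSqrt

lemma complexSqrt_sq (z : ℂ) : z.sqrt ^ 2 = z :=
  Complex.cpow_ofNat_inv_pow z 2

lemma re_complexSqrt_nonneg (z : ℂ) : 0 ≤ z.sqrt.re := by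
  rw [Complex.sqrt, Complex.cpow_inv_two_re]
  positivity

lemma re_sq_sub_im_sq_complexSqrt (z : ℂ) : z.sqrt.re ^ 2 - z.sqrt.im ^ 2 = z.re := by
  simpa [sq] using congrArg Complex.re (complexSqrt_sq z)

lemma two_mul_re_mul_im_complexSqrt (z : ℂ) : 2 * z.sqrt.re * z.sqrt.im = z.im := by
  rw [← congrArg Complex.im (complexSqrt_sq z), sq, Complex.mul_im]
  ring

lemma sqrt_re_le_re_complexSqrt (z : ℂ) : √z.re ≤ z.sqrt.re :=
  Real.sqrt_le_iff.2 ⟨re_complexSqrt_nonneg z,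
    by nlinarith [re_sq_sub_im_sq_complexSqrt z, sq_nonneg z.sqrt.im]⟩

lemma re_complexSqrt_pos {z : ℂ} (hz : 0 < z.re) : 0 < z.sqrt.re :=
  (Real.sqrt_pos.2 hz).trans_le (sqrt_re_le_re_complexSqrt z)

lemma ne_zero_of_re_pos {z : ℂ} (hz : 0 < z.re) : z ≠ 0 := by
  rintro rfl
  exact hz.ne rfl

lemma complexSqrt_eq_of_sq_eq {z w : ℂ} (hw : 0 < w.re) (h : w ^ 2 = z) : z.sqrt = w := by
  rcases sq_eq_sq_iff_eq_or_eq_neg.1 ((complexSqrt_sq z).trans h.symm) with heq | hneg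
  · exact heq
  · have hnonneg := re_complexSqrt_nonneg z
    rw [hneg, Complex.neg_re] at hnonneg
    linarith

lemma complexSqrt_ofReal_mul {r : ℝ} (hr : 0 < r) {z : ℂ} (hz : 0 < z.re) :
    ((r : ℂ) * z).sqrt = (√r : ℝ) * z.sqrt := by
  refine complexSqrt_eq_of_sq_eq ?_ ?_
  · rw [Complex.re_ofReal_mul]
    exact mul_pos (Real.sqrt_pos.2 hr) (re_complexSqrt_pos hz)
  · rw [mul_pow, complexSqrt_sq, ← Complex.ofReal_pow, Real.sq_sqrt hr.le]

lemma tendsto_re_complexSqrt {α : Type*} {l : Filter α} {f : α → ℂ}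
    (hf : Tendsto (fun a => (f a).re) l atTop) :
    Tendsto (fun a => (f a).sqrt.re) l atTop :=
  tendsto_atTop_mono (fun a => sqrt_re_le_re_complexSqrt (f a)) (Real.tendsto_sqrt_atTop.comp hf)

lemma tendsto_inv_of_tendsto_re_atTop {α : Type*} {l : Filter α} {f : α → ℂ}
    (hf : Tendsto (fun a => (f a).re) l atTop) : Tendsto (fun a => (f a)⁻¹) l (𝓝 0) :=
  tendsto_inv₀_cobounded.comp <| tendsto_norm_atTop_iff_cobounded.1 <|
    tendsto_atTop_mono (fun a => Complex.re_le_norm (f a)) hf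

lemma one_add_mul_pow_le_exp {v : ℝ} (hv : 0 ≤ v) :
    1 + 16 * v * (1 + 2 * v) ^ 3 ≤ 36864 * Real.exp v := by
  have hexp : (1 + v / 4) ^ 4 ≤ Real.exp v := by
    rw [show Real.exp v = Real.exp (v / 4) ^ 4 by rw [← Real.exp_nat_mul]; ring_nf]
    gcongr
    linarith [Real.add_one_le_exp (v / 4)]
  calc 1 + 16 * v * (1 + 2 * v) ^ 3
      ≤ (1 + 2 * v) ^ 4 + (8 + 16 * v) * (1 + 2 * v) ^ 3 := by
        gcongr
        · exact one_le_pow₀ (by linarith)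
        · linarith
    _ = 9 * (1 + 2 * v) ^ 4 := by ring
    _ ≤ 9 * (8 * (1 + v / 4)) ^ 4 := by gcongr; linarith
    _ = 36864 * (1 + v / 4) ^ 4 := by ring
    _ ≤ 36864 * Real.exp v := by gcongr

lemma mul_sq_le_of_re_complexSqrt {p : ℝ} (hp : 1 ≤ p) (q : ℝ) {v : ℝ}
    (hv : v = p / 2 * ((1 + q * Complex.I).sqrt.re - 1)) :
    0 ≤ v ∧ p * q ^ 2 ≤ 16 * v * (1 + 2 * v) ^ 3 := by
  obtain ⟨m, hm⟩ : ∃ m, (1 + q * Complex.I).sqrt.re = 1 + m := ⟨_, (add_sub_cancel _ _).symm⟩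
  have hre := re_sq_sub_im_sq_complexSqrt (1 + q * Complex.I)
  have him := two_mul_re_mul_im_complexSqrt (1 + q * Complex.I)
  have hsqrt := sqrt_re_le_re_complexSqrt (1 + q * Complex.I)
  simp only [hm, Complex.add_re, Complex.one_re, Complex.re_ofReal_mul, Complex.I_re, mul_zero,
    add_zero, Real.sqrt_one, Complex.add_im, Complex.one_im, Complex.im_ofReal_mul,
    Complex.I_im, mul_one, zero_add] at hre him hsqrt
  have hm0 : 0 ≤ m := by linarith
  have hq : q ^ 2 = 4 * (1 + m) ^ 2 * (m * (2 + m)) := by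
    rw [← him, mul_pow, mul_pow, show (1 + q * Complex.I).sqrt.im ^ 2 = m * (2 + m) by linarith]
    ring
  rw [hm, add_sub_cancel_left] at hv
  have hmv : m ≤ 2 * v := by nlinarith
  have hv0 : 0 ≤ v := by linarith
  refine ⟨hv0, ?_⟩
  calc p * q ^ 2 = 8 * v * ((1 + m) ^ 2 * (2 + m)) := by rw [hq, hv]; ring
    _ ≤ 8 * v * ((1 + 2 * v) ^ 2 * (2 * (1 + 2 * v))) := by gcongr; linarith
    _ = 16 * v * (1 + 2 * v) ^ 3 := by ring

lemma exp_neg_re_complexSqrt_le {p : ℝ} (hp : 1 ≤ p) (q : ℝ) :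
    Real.exp (-(p / 2 * ((1 + q * Complex.I).sqrt.re - 1))) ≤ 36864 * (1 + p * q ^ 2)⁻¹ := by
  obtain ⟨hv, hpq⟩ := mul_sq_le_of_re_complexSqrt hp q rfl
  rw [Real.exp_neg, ← div_eq_mul_inv, inv_le_comm₀ (Real.exp_pos _) (by positivity), inv_div,
    div_le_iff₀ (by norm_num)]
  linarith [one_add_mul_pow_le_exp hv]

end ComplexSqrt

section SaddlePoint

/-- The transform `L z` divided by the saddle-point profile `√p · exp (-p / 2)`, `p = √(2z)`. -/
noncomputable def normalizedLaplace (L : ℂ → ℂ) (z : ℂ) : ℂ :=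
  L z * Complex.exp ((2 * z).sqrt / 2) / (2 * z).sqrt.sqrt

lemma normalizedLaplace_sq (L : ℂ → ℂ) (z : ℂ) :
    normalizedLaplace L z ^ 2 = L z ^ 2 * Complex.exp (2 * z).sqrt / (2 * z).sqrt := by
  rw [normalizedLaplace, div_pow, mul_pow, complexSqrt_sq, ← Complex.exp_nat_mul, Nat.cast_ofNat,
    mul_div_cancel₀ _ two_ne_zero]

lemma continuousOn_normalizedLaplace {L : ℂ → ℂ} (hL : ContinuousOn L {z | 0 < z.re}) :
    ContinuousOn (normalizedLaplace L) {z | 0 < z.re} := by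
  intro z hz
  have hz2 : 0 < (2 * z).re := by simpa using hz
  have hsqrt : ContinuousAt (fun z : ℂ => (2 * z).sqrt) z :=
    (Complex.continuousAt_sqrt (Or.inl hz2.le)).comp (by fun_prop : ContinuousAt (2 * ·) z)
  have hsqrt_sqrt : ContinuousAt (fun z : ℂ => (2 * z).sqrt.sqrt) z :=
    (Complex.continuousAt_sqrt (Or.inl (re_complexSqrt_nonneg _))).comp
      (f := fun z : ℂ => (2 * z).sqrt) hsqrt
  exact ((hL z hz).mul (hsqrt.div_const 2).cexp.continuousWithinAt).div
    hsqrt_sqrt.continuousWithinAt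
    (ne_zero_of_re_pos (re_complexSqrt_pos (re_complexSqrt_pos hz2)))

lemma re_normalizedLaplace_ofReal_pos {L : ℂ → ℂ} {c : ℝ} (hc : 0 < c) (hL : 0 < (L c).re) :
    0 < (normalizedLaplace L c).re := by
  have hsqrt : (2 * (c : ℂ)).sqrt = (√(2 * c) : ℝ) := by
    simpa using complexSqrt_ofReal_mul (mul_pos two_pos hc) (z := 1) (by simp)
  have hsqrt_sqrt : ((√(2 * c) : ℝ) : ℂ).sqrt = (√√(2 * c) : ℝ) := by
    simpa using complexSqrt_ofReal_mul (Real.sqrt_pos.2 (mul_pos two_pos hc)) (z := 1) (by simp)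
  have hreal : normalizedLaplace L c = L c * (Real.exp (√(2 * c) / 2) / √√(2 * c) : ℝ) := by
    rw [normalizedLaplace, hsqrt, hsqrt_sqrt]
    push_cast
    rw [mul_div_assoc]
  rw [hreal, Complex.re_mul_ofReal]
  positivity

lemma re_pos_of_isPreconnected {X : Type*} [TopologicalSpace X] {s : Set X}
    (hs : IsPreconnected s) {f : X → ℂ} (hf : ContinuousOn f s) (hne : ∀ x ∈ s, (f x).re ≠ 0)
    {a : X} (ha : a ∈ s) (hpos : 0 < (f a).re) {x : X} (hx : x ∈ s) : 0 < (f x).re := by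
  by_contra! hle
  obtain ⟨y, hy, hzero⟩ := hs.intermediate_value hx ha
    (Complex.continuous_re.comp_continuousOn hf) ⟨hle, hpos.le⟩
  exact hne y hy hzero

/-- Only the square of the transform is controlled; the sign of the root is determined by
positivity on the real axis. -/
lemma tendsto_normalizedLaplace {L : ℂ → ℂ} {C : ℝ} (hC : 0 < C)
    (hL : ContinuousOn L {z | 0 < z.re}) (hpos : ∀ c : ℝ, 0 < c → 0 < (L c).re)
    (hlim : Tendsto (fun z => L z ^ 2 * Complex.exp (2 * z).sqrt / (2 * z).sqrt)
      (comap Complex.re atTop) (𝓝 ((C : ℂ) ^ 2))) :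
    Tendsto (normalizedLaplace L) (comap Complex.re atTop) (𝓝 C) := by
  simp only [← normalizedLaplace_sq] at hlim
  have hsq_re : ∀ᶠ z in comap Complex.re atTop, 0 < (normalizedLaplace L z ^ 2).re := by
    refine ((Complex.continuous_re.tendsto _).comp hlim).eventually (lt_mem_nhds ?_)
    rw [← Complex.ofReal_pow, Complex.ofReal_re]
    positivity
  obtain ⟨R, hR⟩ := eventually_atTop.1 (eventually_comap.1 hsq_re)
  have hre : ∀ z ∈ {z : ℂ | max R 0 < z.re}, 0 < (normalizedLaplace L z).re := by
    intro z hz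
    refine re_pos_of_isPreconnected (convex_halfSpace_re_gt (max R 0)).isPreconnected
      ((continuousOn_normalizedLaplace hL).mono fun w hw => (le_max_right R 0).trans_lt hw)
      (fun w hw hzero => ?_) (a := ((max R 0 + 1 : ℝ) : ℂ)) (lt_add_one (max R 0))
      (re_normalizedLaplace_ofReal_pos (by positivity) (hpos _ (by positivity))) hz
    have hsq := hR w.re ((le_max_left R 0).trans hw.le) w rfl
    rw [sq, Complex.mul_re, hzero] at hsq
    nlinarith [sq_nonneg (normalizedLaplace L w).im]
  have hroot : ((C : ℂ) ^ 2).sqrt = C := complexSqrt_eq_of_sq_eq (by simpa using hC) rfl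
  have hsqrt := (Complex.continuousAt_sqrt (z := (C : ℂ) ^ 2)
    (Or.inl (by rw [← Complex.ofReal_pow, Complex.ofReal_re]; positivity))).tendsto.comp hlim
  rw [hroot] at hsqrt
  refine hsqrt.congr' ?_
  filter_upwards [preimage_mem_comap (Ioi_mem_atTop (max R 0))] with z hz
  exact complexSqrt_eq_of_sq_eq (hre z hz) rfl

/-- The principal root `u = √(1 + i τ / √p)`: on the line `Re z = p² / 2` one has
`√(2z) = p u` at height `p^(3/2) τ / 2`, the width of the saddle. -/
noncomputable def saddleRoot (p τ : ℝ) : ℂ := (1 + (τ / √p : ℝ) * Complex.I).sqrt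

/-- The point `z = p² u² / 2` of the line `Re z = p² / 2` belonging to `u = saddleRoot p τ`. -/
noncomputable def saddlePoint (p τ : ℝ) : ℂ :=
  ((p ^ 2 / 2 : ℝ) : ℂ) + (p ^ 2 / 2 / √p * τ : ℝ) * Complex.I

/-- The Bromwich integrand at `x = 1 / (2p)` in the variable `τ`, normalized by `exp (p / 4)`.
The exponent is `z x - p u / 2 = p (u - 1)² / 4 - p / 4`. -/
noncomputable def saddleIntegrand (L : ℂ → ℂ) (p τ : ℝ) : ℂ :=
  normalizedLaplace L (saddlePoint p τ) * ((saddleRoot p τ).sqrt / saddleRoot p τ ^ 2) *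
    Complex.exp (p / 4 * (saddleRoot p τ - 1) ^ 2)

lemma saddleRoot_sq (p τ : ℝ) : saddleRoot p τ ^ 2 = 1 + (τ / √p : ℝ) * Complex.I :=
  complexSqrt_sq _

lemma one_le_re_saddleRoot (p τ : ℝ) : 1 ≤ (saddleRoot p τ).re := by
  have hre : (1 + (τ / √p : ℝ) * Complex.I : ℂ).re = 1 := by
    simp only [Complex.add_re, Complex.one_re, Complex.re_ofReal_mul, Complex.I_re, mul_zero,
      add_zero]
  have hsqrt := sqrt_re_le_re_complexSqrt (1 + (τ / √p : ℝ) * Complex.I)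
  rwa [hre, Real.sqrt_one] at hsqrt

lemma one_le_norm_saddleRoot (p τ : ℝ) : 1 ≤ ‖saddleRoot p τ‖ :=
  (one_le_re_saddleRoot p τ).trans (Complex.re_le_norm _)

lemma saddleRoot_ne_zero (p τ : ℝ) : saddleRoot p τ ≠ 0 :=
  norm_pos_iff.1 (one_pos.trans_le (one_le_norm_saddleRoot p τ))

lemma re_saddlePoint (p τ : ℝ) : (saddlePoint p τ).re = p ^ 2 / 2 := by
  rw [saddlePoint, Complex.add_re, Complex.ofReal_re, Complex.re_ofReal_mul, Complex.I_re,
    mul_zero, add_zero]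

lemma two_mul_saddlePoint (p τ : ℝ) : 2 * saddlePoint p τ = (p ^ 2 : ℝ) * saddleRoot p τ ^ 2 := by
  rw [saddleRoot_sq, saddlePoint]
  push_cast
  ring

lemma saddlePoint_ne_zero {p : ℝ} (hp : 0 < p) (τ : ℝ) : saddlePoint p τ ≠ 0 :=
  ne_zero_of_re_pos (by rw [re_saddlePoint]; positivity)

lemma continuous_saddlePoint (p : ℝ) : Continuous (saddlePoint p) := by
  unfold saddlePoint
  fun_prop

lemma sqrt_two_mul_saddlePoint {p : ℝ} (hp : 0 < p) (τ : ℝ) :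
    (2 * saddlePoint p τ).sqrt = p * saddleRoot p τ := by
  refine complexSqrt_eq_of_sq_eq ?_ ?_
  · rw [Complex.re_ofReal_mul]
    exact mul_pos hp (one_pos.trans_le (one_le_re_saddleRoot p τ))
  · rw [two_mul_saddlePoint, mul_pow, Complex.ofReal_pow]

lemma cexp_saddlePoint {p : ℝ} (hp : 0 < p) (τ : ℝ) :
    Complex.exp (saddlePoint p τ * (1 / (2 * p) : ℝ)) * Real.exp (p / 4) =
      Complex.exp (p / 4 * (saddleRoot p τ - 1) ^ 2) * Complex.exp (p * saddleRoot p τ / 2) := by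
  have hpc : (p : ℂ) ≠ 0 := Complex.ofReal_ne_zero.2 hp.ne'
  have hz := two_mul_saddlePoint p τ
  rw [Complex.ofReal_exp, ← Complex.exp_add, ← Complex.exp_add]
  congr 1
  rw [← mul_right_inj' (two_ne_zero (α := ℂ)), mul_add, ← mul_assoc, hz]
  push_cast
  field_simp
  ring

lemma saddleIntegrand_eq (L : ℂ → ℂ) {p : ℝ} (hp : 0 < p) (τ : ℝ) :
    saddleIntegrand L p τ = Complex.exp (saddlePoint p τ * (1 / (2 * p) : ℝ)) *
      (L (saddlePoint p τ) / saddlePoint p τ) * (p ^ 2 / 2 / √p : ℝ) * Real.exp (p / 4) := by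
  have hre : 0 < (saddleRoot p τ).re := one_pos.trans_le (one_le_re_saddleRoot p τ)
  have hu := saddleRoot_ne_zero p τ
  have hu_sqrt := ne_zero_of_re_pos (re_complexSqrt_pos hre)
  have hp_sqrt : ((√p : ℝ) : ℂ) ≠ 0 := Complex.ofReal_ne_zero.2 (Real.sqrt_pos.2 hp).ne'
  have hpc : (p : ℂ) ≠ 0 := Complex.ofReal_ne_zero.2 hp.ne'
  have hz : saddlePoint p τ = p ^ 2 * saddleRoot p τ ^ 2 / 2 := by
    rw [eq_div_iff two_ne_zero, mul_comm, two_mul_saddlePoint, Complex.ofReal_pow]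
  rw [saddleIntegrand, normalizedLaplace, sqrt_two_mul_saddlePoint hp,
    complexSqrt_ofReal_mul hp hre]
  calc _ = L (saddlePoint p τ) / (√p * saddleRoot p τ ^ 2) *
        (Complex.exp (p / 4 * (saddleRoot p τ - 1) ^ 2) *
          Complex.exp (p * saddleRoot p τ / 2)) := by field_simp
    _ = L (saddlePoint p τ) / saddlePoint p τ * (p ^ 2 / 2 / √p : ℝ) *
        (Complex.exp (saddlePoint p τ * (1 / (2 * p) : ℝ)) * Real.exp (p / 4)) := by
      rw [← cexp_saddlePoint hp]
      congr 1
      nth_rewrite 3 [hz]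
      push_cast
      field_simp
    _ = _ := by ring

lemma norm_cexp_saddleRoot_le {p : ℝ} (hp : 1 ≤ p) (τ : ℝ) :
    ‖Complex.exp (p / 4 * (saddleRoot p τ - 1) ^ 2)‖ ≤ 36864 * (1 + τ ^ 2)⁻¹ := by
  have hp0 : 0 < p := by linarith
  have hexpand : (p / 4 * (saddleRoot p τ - 1) ^ 2 : ℂ) =
      ((p / 4 : ℝ) : ℂ) * (2 + (τ / √p : ℝ) * Complex.I - (2 : ℝ) * saddleRoot p τ) := by
    rw [sub_sq, saddleRoot_sq]
    push_cast
    ring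
  have hre : (p / 4 * (saddleRoot p τ - 1) ^ 2 : ℂ).re =
      -(p / 2 * ((saddleRoot p τ).re - 1)) := by
    rw [hexpand, Complex.re_ofReal_mul, Complex.sub_re, Complex.add_re, Complex.re_ofReal_mul,
      Complex.re_ofReal_mul, Complex.I_re, Complex.re_ofNat]
    ring
  have hsq : p * (τ / √p) ^ 2 = τ ^ 2 := by
    rw [div_pow, Real.sq_sqrt hp0.le, mul_div_cancel₀ _ hp0.ne']
  rw [Complex.norm_exp, hre, ← hsq]
  exact exp_neg_re_complexSqrt_le hp (τ / √p)

lemma norm_sqrt_div_sq_saddleRoot_le (p τ : ℝ) :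
    ‖(saddleRoot p τ).sqrt / saddleRoot p τ ^ 2‖ ≤ 1 := by
  have hnorm := one_le_norm_saddleRoot p τ
  have hsq : ‖(saddleRoot p τ).sqrt‖ ^ 2 = ‖saddleRoot p τ‖ := by
    rw [← norm_pow, complexSqrt_sq]
  rw [norm_div, norm_pow, div_le_one (pow_pos (one_pos.trans_le hnorm) 2), ← hsq, ← pow_mul]
  refine le_self_pow₀ ?_ (by norm_num)
  exact (one_le_sq_iff₀ (norm_nonneg _)).1 (hsq ▸ hnorm)

lemma tendsto_saddlePoint (τ : ℝ) :
    Tendsto (fun p => saddlePoint p τ) atTop (comap Complex.re atTop) := by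
  simp only [tendsto_comap_iff, Function.comp_def, re_saddlePoint]
  exact (tendsto_pow_atTop two_ne_zero).atTop_div_const two_pos

lemma tendsto_saddleRoot (τ : ℝ) : Tendsto (fun p => saddleRoot p τ) atTop (𝓝 1) := by
  have hquot : Tendsto (fun p : ℝ => ((τ / √p : ℝ) : ℂ)) atTop (𝓝 ((0 : ℝ) : ℂ)) :=
    (Complex.continuous_ofReal.tendsto _).comp
      (tendsto_const_nhds.div_atTop Real.tendsto_sqrt_atTop)
  have harg := (hquot.mul_const Complex.I).const_add 1
  rw [Complex.ofReal_zero, zero_mul, add_zero] at harg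
  have hroot := (Complex.continuousAt_sqrt (z := 1) (Or.inl (by simp))).tendsto.comp harg
  rwa [Complex.sqrt_one] at hroot

lemma saddle_exponent_eq {p : ℝ} (hp : 0 < p) (τ : ℝ) :
    (p / 4 * (saddleRoot p τ - 1) ^ 2 : ℂ) = -((τ : ℂ) ^ 2 / 4) / (saddleRoot p τ + 1) ^ 2 := by
  have hne : saddleRoot p τ + 1 ≠ 0 := ne_zero_of_re_pos <| by
    rw [Complex.add_re, Complex.one_re]
    linarith [one_le_re_saddleRoot p τ]
  have hprod : (saddleRoot p τ - 1) * (saddleRoot p τ + 1) = (τ / √p : ℝ) * Complex.I := by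
    linear_combination saddleRoot_sq p τ
  have hpc : (p : ℂ) ≠ 0 := Complex.ofReal_ne_zero.2 hp.ne'
  rw [eq_div_iff (pow_ne_zero _ hne), mul_assoc, ← mul_pow, hprod, mul_pow, Complex.I_sq,
    ← Complex.ofReal_pow, div_pow, Real.sq_sqrt hp.le]
  push_cast
  field_simp

lemma tendsto_saddleIntegrand {L : ℂ → ℂ} {C : ℝ}
    (hL : Tendsto (normalizedLaplace L) (comap Complex.re atTop) (𝓝 C)) (τ : ℝ) :
    Tendsto (fun p => saddleIntegrand L p τ) atTop
      (𝓝 ((C * Real.exp (-(1 / 16) * τ ^ 2) : ℝ) : ℂ)) := by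
  have hroot := tendsto_saddleRoot τ
  have hroot_sqrt := (Complex.continuousAt_sqrt (z := 1) (Or.inl (by simp))).tendsto.comp hroot
  rw [Complex.sqrt_one] at hroot_sqrt
  have hfactor := hroot_sqrt.div (hroot.pow 2) (by simp)
  have hexponent : Tendsto (fun p : ℝ => (p / 4 * (saddleRoot p τ - 1) ^ 2 : ℂ)) atTop
      (𝓝 (-((τ : ℂ) ^ 2 / 4) / (1 + 1) ^ 2)) := by
    refine (tendsto_const_nhds.div ((hroot.add_const 1).pow 2) (by norm_num)).congr' ?_
    filter_upwards [eventually_gt_atTop 0] with p hp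
    exact (saddle_exponent_eq hp τ).symm
  have hval : (C : ℂ) * (1 / 1 ^ 2) * Complex.exp (-((τ : ℂ) ^ 2 / 4) / (1 + 1) ^ 2) =
      ((C * Real.exp (-(1 / 16) * τ ^ 2) : ℝ) : ℂ) := by
    push_cast
    ring_nf
  exact hval ▸ ((hL.comp (tendsto_saddlePoint τ)).mul hfactor).mul hexponent.cexp

lemma eventually_norm_saddleIntegrand_le {L : ℂ → ℂ} {C : ℝ}
    (hL : Tendsto (normalizedLaplace L) (comap Complex.re atTop) (𝓝 C)) :
    ∀ᶠ p : ℝ in atTop, ∀ τ : ℝ,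
      ‖saddleIntegrand L p τ‖ ≤ (|C| + 1) * (36864 * (1 + τ ^ 2)⁻¹) := by
  have hbound : ∀ᶠ z in comap Complex.re atTop, ‖normalizedLaplace L z‖ < |C| + 1 :=
    hL.norm.eventually <| gt_mem_nhds <| by
      rw [Complex.norm_real, Real.norm_eq_abs]
      exact lt_add_one _
  obtain ⟨R, hR⟩ := eventually_atTop.1 (eventually_comap.1 hbound)
  have hline : Tendsto (fun p : ℝ => p ^ 2 / 2) atTop atTop :=
    (tendsto_pow_atTop two_ne_zero).atTop_div_const two_pos
  filter_upwards [hline.eventually_ge_atTop R, eventually_ge_atTop 1] with p hp hp1 τ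
  rw [saddleIntegrand, norm_mul, norm_mul, ← mul_one (|C| + 1)]
  gcongr
  · exact (hR _ hp _ (re_saddlePoint p τ)).le
  · exact norm_sqrt_div_sq_saddleRoot_le p τ
  · exact norm_cexp_saddleRoot_le hp1 τ

lemma integrable_saddle_majorant (C : ℝ) :
    Integrable fun τ : ℝ => (|C| + 1) * (36864 * (1 + τ ^ 2)⁻¹) :=
  (integrable_inv_one_add_sq.const_mul _).const_mul _

lemma continuous_comp_saddlePoint_div {L : ℂ → ℂ} (hL : ContinuousOn L {z | 0 < z.re}) {p : ℝ}
    (hp : 0 < p) : Continuous fun τ => L (saddlePoint p τ) / saddlePoint p τ :=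
  (hL.comp_continuous (continuous_saddlePoint p) fun τ => by
    rw [Set.mem_ofPred_eq, re_saddlePoint]; positivity).div
    (continuous_saddlePoint p) (saddlePoint_ne_zero hp)

lemma continuous_saddleIntegrand {L : ℂ → ℂ} (hL : ContinuousOn L {z | 0 < z.re}) {p : ℝ}
    (hp : 0 < p) : Continuous (saddleIntegrand L p) := by
  rw [funext (saddleIntegrand_eq L hp)]
  have hexp : Continuous fun τ => Complex.exp (saddlePoint p τ * (1 / (2 * p) : ℝ)) :=
    ((continuous_saddlePoint p).mul_const _).cexp
  exact ((hexp.mul (continuous_comp_saddlePoint_div hL hp)).mul_const _).mul_const _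

lemma tendsto_integral_saddleIntegrand {L : ℂ → ℂ} (hL : ContinuousOn L {z | 0 < z.re}) {C : ℝ}
    (hlim : Tendsto (normalizedLaplace L) (comap Complex.re atTop) (𝓝 C)) :
    Tendsto (fun p => ∫ τ, saddleIntegrand L p τ) atTop (𝓝 ((C * (4 * √Real.pi) : ℝ) : ℂ)) := by
  have hgauss : ∫ τ : ℝ, ((C * Real.exp (-(1 / 16) * τ ^ 2) : ℝ) : ℂ) =
      ((C * (4 * √Real.pi) : ℝ) : ℂ) := by
    rw [integral_complex_ofReal, integral_const_mul, integral_gaussian,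
      show Real.pi / (1 / 16) = 4 ^ 2 * Real.pi by ring, Real.sqrt_mul (by positivity),
      Real.sqrt_sq (by norm_num)]
  rw [← hgauss]
  exact tendsto_integral_filter_of_dominated_convergence _
    ((eventually_gt_atTop 0).mono fun p hp =>
      (continuous_saddleIntegrand hL hp).aestronglyMeasurable)
    ((eventually_norm_saddleIntegrand_le hlim).mono fun p hp => Eventually.of_forall hp)
    (integrable_saddle_majorant C)
    (Eventually.of_forall (tendsto_saddleIntegrand hlim))

lemma integral_comp_saddlePoint (F : ℂ → ℂ) {p : ℝ} (hp : 0 < p) :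
    (∫ τ, F (saddlePoint p τ)) * (p ^ 2 / 2 / √p : ℝ) =
      ∫ y : ℝ, F ((p ^ 2 / 2 : ℝ) + y * Complex.I) := by
  have hscale : 0 < p ^ 2 / 2 / √p := by positivity
  simp only [saddlePoint]
  rw [Measure.integral_comp_mul_left (fun y : ℝ => F ((p ^ 2 / 2 : ℝ) + y * Complex.I)),
    abs_of_pos (inv_pos.2 hscale), Complex.real_smul, mul_right_comm, ← Complex.ofReal_mul,
    inv_mul_cancel₀ hscale.ne', Complex.ofReal_one, one_mul]

lemma eventually_integrable_bromwich {L : ℂ → ℂ} (hL : ContinuousOn L {z | 0 < z.re}) {C : ℝ}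
    (hlim : Tendsto (normalizedLaplace L) (comap Complex.re atTop) (𝓝 C)) :
    ∀ᶠ p : ℝ in atTop, Integrable fun y : ℝ =>
      L ((p ^ 2 / 2 : ℝ) + y * Complex.I) / ((p ^ 2 / 2 : ℝ) + y * Complex.I) := by
  filter_upwards [eventually_norm_saddleIntegrand_le hlim, eventually_gt_atTop 0] with p hbound hp
  have hscale : 0 < p ^ 2 / 2 / √p := by positivity
  rw [← integrable_comp_mul_left_iff _ hscale.ne']
  change Integrable fun τ => L (saddlePoint p τ) / saddlePoint p τ
  have hnorm : ∀ τ, ‖saddleIntegrand L p τ‖ =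
      ‖L (saddlePoint p τ) / saddlePoint p τ‖ *
        (Real.exp (p ^ 2 / 2 * (1 / (2 * p))) * (p ^ 2 / 2 / √p) * Real.exp (p / 4)) := by
    intro τ
    rw [saddleIntegrand_eq L hp, norm_mul, norm_mul, norm_mul, Complex.norm_exp,
      Complex.re_mul_ofReal, re_saddlePoint, Complex.norm_of_nonneg hscale.le,
      Complex.norm_of_nonneg (Real.exp_pos _).le]
    ring
  have hint := ((integrable_saddle_majorant C).mono'
    (continuous_saddleIntegrand hL hp).aestronglyMeasurable (Eventually.of_forall hbound)).norm
  simp only [hnorm] at hint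
  rw [integrable_mul_const_iff (IsUnit.mk0 _ (by positivity))] at hint
  exact (integrable_norm_iff
    (continuous_comp_saddlePoint_div hL hp).aestronglyMeasurable).1 hint

theorem tendsto_bromwich {L : ℂ → ℂ} (hL : ContinuousOn L {z | 0 < z.re}) {C : ℝ}
    (hlim : Tendsto (normalizedLaplace L) (comap Complex.re atTop) (𝓝 C)) :
    Tendsto (fun p : ℝ => (2 * Real.pi : ℂ)⁻¹ * (∫ y : ℝ,
      Complex.exp (((p ^ 2 / 2 : ℝ) + y * Complex.I) * (1 / (2 * p) : ℝ)) *
      (L ((p ^ 2 / 2 : ℝ) + y * Complex.I) / ((p ^ 2 / 2 : ℝ) + y * Complex.I))) *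
        Real.exp (p / 4)) atTop (𝓝 ((2 * C / √Real.pi : ℝ) : ℂ)) := by
  have hval : (2 * Real.pi)⁻¹ * (C * (4 * √Real.pi)) = 2 * C / √Real.pi := by
    have hsqrt : √Real.pi ≠ 0 := (Real.sqrt_pos.2 Real.pi_pos).ne'
    field_simp
    rw [Real.sq_sqrt Real.pi_pos.le]
    ring
  have htendsto := (tendsto_integral_saddleIntegrand hL hlim).const_mul (2 * Real.pi : ℂ)⁻¹
  rw [← hval]
  push_cast at htendsto ⊢
  refine htendsto.congr' ?_
  filter_upwards [eventually_gt_atTop 0] with p hp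
  have hchange := integral_comp_saddlePoint
    (fun z => Complex.exp (z * (1 / (2 * p) : ℝ)) * (L z / z)) hp
  push_cast at hchange
  rw [← hchange, mul_assoc]
  congr 1
  simp only [saddleIntegrand_eq L hp]
  rw [integral_mul_const, integral_mul_const]
  push_cast
  ring

end SaddlePoint

section LaplaceTransform

variable {μ : Measure ℝ}

lemma Iio_zero_subset_interior_integrableExpSet [IsFiniteMeasure μ] (hμ : ∀ᵐ x ∂μ, 0 ≤ x) :
    Set.Iio 0 ⊆ interior (integrableExpSet id μ) := by
  refine interior_maximal (fun t ht => ?_) isOpen_Iio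
  refine (integrable_const (1 : ℝ)).mono' (by fun_prop) ?_
  filter_upwards [hμ] with x hx
  rw [Real.norm_of_nonneg (Real.exp_pos _).le, Real.exp_le_one_iff]
  exact mul_nonpos_of_nonpos_of_nonneg (Set.mem_Iio.1 ht).le hx

lemma differentiableOn_complexMGF_neg [IsFiniteMeasure μ] (hμ : ∀ᵐ x ∂μ, 0 ≤ x) :
    DifferentiableOn ℂ (fun z => complexMGF id μ (-z)) {z | 0 < z.re} := fun z hz =>
  ((analyticAt_complexMGF (Iio_zero_subset_interior_integrableExpSet hμ
    (show (-z).re < 0 from neg_neg_of_pos hz))).differentiableAt.fun_comp' z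
    differentiableAt_fun_id.neg).differentiableWithinAt

variable [IsProbabilityMeasure μ]

lemma re_complexMGF_neg_ofReal_pos (hμ : ∀ᵐ x ∂μ, 0 ≤ x) {c : ℝ} (hc : 0 < c) :
    0 < (complexMGF id μ (-(c : ℂ))).re := by
  rw [← Complex.ofReal_neg, complexMGF_ofReal, Complex.ofReal_re]
  have hmem : -c ∈ integrableExpSet id μ :=
    interior_subset (Iio_zero_subset_interior_integrableExpSet hμ (neg_neg_of_pos hc))
  exact mgf_pos hmem

/-- A Laplace transform asymptotic to `C (2z)^(1/4) exp (-√(2z) / 2)` has its saddle point for the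
argument `x` at `√(2z) = 1 / (2x)`. -/
theorem tendsto_cdf_mul_exp (hμ : ∀ᵐ x ∂μ, 0 ≤ x) {C : ℝ} (hC : 0 < C)
    (hlim : Tendsto (fun z => complexMGF id μ (-z) ^ 2 * Complex.exp (2 * z).sqrt / (2 * z).sqrt)
      (comap Complex.re atTop) (𝓝 ((C : ℂ) ^ 2))) :
    Tendsto (fun x => cdf μ x * Real.exp (1 / 8 * x⁻¹)) (𝓝[>] 0)
      (𝓝 (2 * C / √Real.pi)) := by
  have hL := (differentiableOn_complexMGF_neg hμ).continuousOn
  have hnormalized := tendsto_normalizedLaplace hC hL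
    (fun c hc => re_complexMGF_neg_ofReal_pos hμ hc) hlim
  have hp : Tendsto (fun x : ℝ => x⁻¹ / 2) (𝓝[>] 0) atTop :=
    tendsto_inv_nhdsGT_zero.atTop_div_const two_pos
  have hcomplex := (tendsto_bromwich hL hnormalized).comp hp
  rw [← tendsto_ofReal_iff]
  refine hcomplex.congr' ?_
  filter_upwards [hp.eventually (eventually_integrable_bromwich hL hnormalized),
    self_mem_nhdsWithin] with x hint hx
  have hx0 : 0 < x := hx
  have hsaddle : 1 / (2 * (x⁻¹ / 2)) = x := by field_simp
  have hexp : x⁻¹ / 2 / 4 = 1 / 8 * x⁻¹ := by ring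
  simp only [Function.comp_apply, hsaddle, hexp]
  push_cast
  rw [cdf_eq_bromwich hμ (by positivity) hint]
  push_cast
  rfl

end LaplaceTransform

section FredholmDeterminant

/-- The Fredholm determinant `det (1 + 2zK)` of the demeaned Ornstein-Uhlenbeck covariance `K`, as
a function of `γ = √(2z + β²)`. -/
noncomputable def fredholmDet (β : ℝ) (γ : ℂ) : ℂ :=
  Complex.exp (-β) / γ ^ 4 * (γ * Complex.cosh (γ / 2) + β * Complex.sinh (γ / 2)) *
    (((β + 2) * γ ^ 2 - 2 * β ^ 2) * Complex.sinh (γ / 2) + β ^ 2 * γ * Complex.cosh (γ / 2))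

/-- `fredholmDet` at real arguments. -/
noncomputable def fredholmDetReal (β γ : ℝ) : ℝ :=
  Real.exp (-β) / γ ^ 4 * (γ * Real.cosh (γ / 2) + β * Real.sinh (γ / 2)) *
    (((β + 2) * γ ^ 2 - 2 * β ^ 2) * Real.sinh (γ / 2) + β ^ 2 * γ * Real.cosh (γ / 2))

lemma ofReal_fredholmDetReal (β γ : ℝ) : (fredholmDetReal β γ : ℂ) = fredholmDet β γ := by
  simp [fredholmDetReal, fredholmDet]

/-- The correction to `fredholmDet β γ ≈ exp (γ - β) / (4γ)`, as a function of `e = exp (-γ)` and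
`i = 1 / γ`. -/
noncomputable def detFactor (β : ℝ) (e i : ℂ) : ℂ :=
  ((1 + e) + β * i * (1 - e)) * ((β + 2 - 2 * β ^ 2 * i ^ 2) * (1 - e) + β ^ 2 * i * (1 + e))

lemma fredholmDet_eq (β : ℝ) {γ : ℂ} (hγ : γ ≠ 0) :
    fredholmDet β γ = Complex.exp (γ - β) / (4 * γ) * detFactor β (Complex.exp (-γ)) γ⁻¹ := by
  have hne : Complex.exp (γ / 2) ≠ 0 := Complex.exp_ne_zero _
  have hexp : Complex.exp γ = Complex.exp (γ / 2) ^ 2 := by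
    rw [← Complex.exp_nat_mul, Nat.cast_ofNat, mul_div_cancel₀ _ two_ne_zero]
  rw [fredholmDet, detFactor, Complex.cosh, Complex.sinh, sub_eq_add_neg γ, Complex.exp_add,
    Complex.exp_neg γ, Complex.exp_neg (γ / 2), hexp]
  field_simp
  ring

lemma tendsto_re_sqrt_two_mul_add (a : ℂ) :
    Tendsto (fun z : ℂ => (2 * z + a).sqrt.re) (comap Complex.re atTop) atTop := by
  refine tendsto_re_complexSqrt ?_
  have hre : Tendsto (fun z : ℂ => 2 * z.re + a.re) (comap Complex.re atTop) atTop :=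
    tendsto_atTop_add_const_right _ _ (tendsto_comap.const_mul_atTop two_pos)
  simpa using hre

lemma tendsto_re_sqrt_two_mul :
    Tendsto (fun z : ℂ => (2 * z).sqrt.re) (comap Complex.re atTop) atTop := by
  simpa using tendsto_re_sqrt_two_mul_add 0

lemma tendsto_sqrt_sub_sqrt_add (a : ℂ) :
    Tendsto (fun z : ℂ => (2 * z).sqrt - (2 * z + a).sqrt) (comap Complex.re atTop) (𝓝 0) := by
  have hsum : Tendsto (fun z : ℂ => ((2 * z).sqrt + (2 * z + a).sqrt).re)
      (comap Complex.re atTop) atTop :=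
    tendsto_re_sqrt_two_mul.atTop_add_atTop (tendsto_re_sqrt_two_mul_add a)
  have hquot := (tendsto_inv_of_tendsto_re_atTop hsum).const_mul (-a)
  rw [mul_zero] at hquot
  refine hquot.congr' ?_
  filter_upwards [hsum.eventually_gt_atTop 0] with z hz
  rw [← div_eq_mul_inv, div_eq_iff (ne_zero_of_re_pos hz)]
  linear_combination complexSqrt_sq (2 * z + a) - complexSqrt_sq (2 * z)

lemma tendsto_detFactor (β : ℝ) {α : Type*} {l : Filter α} {γ : α → ℂ}
    (hγ : Tendsto (fun x => (γ x).re) l atTop) :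
    Tendsto (fun x => detFactor β (Complex.exp (-γ x)) (γ x)⁻¹) l (𝓝 (2 + β)) := by
  have hinv := tendsto_inv_of_tendsto_re_atTop hγ
  have hexp : Tendsto (fun x => Complex.exp (-γ x)) l (𝓝 0) := by
    rw [tendsto_zero_iff_norm_tendsto_zero]
    simp_rw [Complex.norm_exp, Complex.neg_re]
    exact Real.tendsto_exp_neg_atTop_nhds_zero.comp hγ
  have hcont : Continuous fun q : ℂ × ℂ => detFactor β q.1 q.2 := by
    unfold detFactor
    fun_prop
  have hlim := (hcont.tendsto (0, 0)).comp (hexp.prodMk_nhds hinv)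
  have hzero : detFactor β 0 0 = 2 + β := by simp [detFactor, add_comm]
  rwa [hzero] at hlim

lemma inv_fredholmDet_mul_exp_div (β : ℝ) {γ p : ℂ} (hγ : γ ≠ 0) (hp : p ≠ 0) :
    (fredholmDet β γ)⁻¹ * Complex.exp p / p = 4 * ((1 - (p - γ) * p⁻¹) *
      Complex.exp (p - γ + β)) / detFactor β (Complex.exp (-γ)) γ⁻¹ := by
  have hexp : Complex.exp (p - γ + β) = Complex.exp p * (Complex.exp (γ - β))⁻¹ := by
    rw [← Complex.exp_neg, ← Complex.exp_add]
    ring_nf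
  have hratio : 1 - (p - γ) * p⁻¹ = γ * p⁻¹ := by
    rw [sub_mul, mul_inv_cancel₀ hp, sub_sub_cancel]
  rw [fredholmDet_eq β hγ, hexp, hratio, mul_inv, inv_div]
  ring

lemma tendsto_inv_fredholmDet {β : ℝ} (hβ : 2 + β ≠ 0) :
    Tendsto (fun z : ℂ => (fredholmDet β (2 * z + β ^ 2).sqrt)⁻¹ * Complex.exp (2 * z).sqrt /
      (2 * z).sqrt) (comap Complex.re atTop) (𝓝 ((4 * Real.exp β / (2 + β) : ℝ) : ℂ)) := by
  have hp := tendsto_re_sqrt_two_mul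
  have hγ := tendsto_re_sqrt_two_mul_add ((β : ℂ) ^ 2)
  have hdiff := tendsto_sqrt_sub_sqrt_add ((β : ℂ) ^ 2)
  have hratio := (hdiff.mul (tendsto_inv_of_tendsto_re_atTop hp)).const_sub 1
  have hne : (2 + β : ℂ) ≠ 0 := by exact_mod_cast hβ
  have hlim := ((hratio.mul (hdiff.add_const (β : ℂ)).cexp).const_mul 4).div
    (tendsto_detFactor β hγ) hne
  have hval : 4 * ((1 - 0 * 0) * Complex.exp (0 + β)) / (2 + β) =
      ((4 * Real.exp β / (2 + β) : ℝ) : ℂ) := by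
    push_cast
    ring_nf
  rw [hval] at hlim
  refine hlim.congr' ?_
  filter_upwards [hp.eventually_gt_atTop 0, hγ.eventually_gt_atTop 0] with z hpz hγz
  exact (inv_fredholmDet_mul_exp_div β (ne_zero_of_re_pos hγz) (ne_zero_of_re_pos hpz)).symm

lemma eqOn_re_pos_of_eq_ofReal {f g : ℂ → ℂ} (hf : DifferentiableOn ℂ f {z | 0 < z.re})
    (hg : DifferentiableOn ℂ g {z | 0 < z.re}) (h : ∀ t : ℝ, 0 < t → f t = g t) :
    Set.EqOn f g {z | 0 < z.re} := by
  have hopen : IsOpen {z : ℂ | 0 < z.re} := isOpen_lt continuous_const Complex.continuous_re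
  have hcoe : Tendsto (fun t : ℝ => (t : ℂ)) (𝓝[≠] 1) (𝓝[≠] 1) := by
    simpa using Complex.continuous_ofReal.continuousAt.continuousWithinAt.tendsto_nhdsWithin
      (s := {1}ᶜ) (x := 1) (t := {1}ᶜ) fun t ht => by simpa using ht
  refine (hf.analyticOnNhd hopen).eqOn_of_preconnected_of_frequently_eq (hg.analyticOnNhd hopen)
    (convex_halfSpace_re_gt 0).isPreconnected (z₀ := 1) (by simp)
    (hcoe.frequently (Eventually.frequently ?_))
  filter_upwards [nhdsWithin_le_nhds (lt_mem_nhds one_pos)] with t ht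
  exact h t ht

lemma re_two_mul_add_sq_pos (β : ℝ) {z : ℂ} (hz : 0 < z.re) :
    0 < (2 * z + (β : ℂ) ^ 2).re := by
  rw [← Complex.ofReal_pow, Complex.add_re, Complex.ofReal_re, Complex.mul_re, Complex.re_ofNat,
    Complex.im_ofNat]
  nlinarith [sq_nonneg β]

lemma differentiableOn_fredholmDet_sqrt (β : ℝ) :
    DifferentiableOn ℂ (fun z : ℂ => fredholmDet β (2 * z + β ^ 2).sqrt) {z | 0 < z.re} := by
  intro z hz
  have hre := re_two_mul_add_sq_pos β hz
  have hroot : DifferentiableAt ℂ (fun z : ℂ => (2 * z + (β : ℂ) ^ 2).sqrt) z :=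
    (Complex.differentiableAt_sqrt (Or.inl hre)).fun_comp' z
      (by fun_prop : DifferentiableAt ℂ (fun z : ℂ => 2 * z + (β : ℂ) ^ 2) z)
  have hdet : DifferentiableAt ℂ (fredholmDet β) (2 * z + (β : ℂ) ^ 2).sqrt := by
    have hne : (2 * z + (β : ℂ) ^ 2).sqrt ^ 4 ≠ 0 :=
      pow_ne_zero _ (ne_zero_of_re_pos (re_complexSqrt_pos hre))
    unfold fredholmDet
    fun_prop (disch := assumption)
  exact (hdet.comp z hroot).differentiableWithinAt

lemma sq_mul_fredholmDet_eq_one {β : ℝ} {L : ℂ → ℂ} (hL : DifferentiableOn ℂ L {z | 0 < z.re})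
    (h : ∀ s : ℝ, 0 < s → L s ^ 2 * fredholmDetReal β √(2 * s + β ^ 2) = 1) {z : ℂ}
    (hz : 0 < z.re) : L z ^ 2 * fredholmDet β (2 * z + β ^ 2).sqrt = 1 := by
  refine eqOn_re_pos_of_eq_ofReal ((hL.pow 2).mul (differentiableOn_fredholmDet_sqrt β))
    (differentiableOn_const 1) (fun s hs => ?_) hz
  have hroot : (2 * (s : ℂ) + (β : ℂ) ^ 2).sqrt = ((√(2 * s + β ^ 2) : ℝ) : ℂ) := by
    simpa using complexSqrt_ofReal_mul (by positivity : 0 < 2 * s + β ^ 2) (z := 1) (by simp)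
  simp only [Pi.mul_apply, Pi.pow_apply, hroot, ← ofReal_fredholmDetReal]
  exact h s hs

theorem tendsto_cdf_mul_exp_of_sq_mul_fredholmDetReal {μ : Measure ℝ} [IsProbabilityMeasure μ]
    (hμ : ∀ᵐ x ∂μ, 0 ≤ x) {β : ℝ} (hβ : 0 < 2 + β)
    (h : ∀ s : ℝ, 0 < s → mgf id μ (-s) ^ 2 * fredholmDetReal β √(2 * s + β ^ 2) = 1) :
    Tendsto (fun x => cdf μ x * Real.exp (1 / 8 * x⁻¹)) (𝓝[>] 0)
      (𝓝 (2 * √(4 * Real.exp β / (2 + β)) / √Real.pi)) := by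
  have hcont : ∀ z : ℂ, 0 < z.re →
      complexMGF id μ (-z) ^ 2 * fredholmDet β (2 * z + β ^ 2).sqrt = 1 := fun z hz =>
    sq_mul_fredholmDet_eq_one (differentiableOn_complexMGF_neg hμ) (fun s hs => by
      rw [← Complex.ofReal_neg, complexMGF_ofReal]
      exact_mod_cast h s hs) hz
  refine tendsto_cdf_mul_exp hμ (by positivity) ?_
  rw [← Complex.ofReal_pow, Real.sq_sqrt (by positivity)]
  refine (tendsto_inv_fredholmDet hβ.ne').congr' ?_
  filter_upwards [tendsto_comap.eventually_gt_atTop 0] with z hz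
  rw [← eq_inv_of_mul_eq_one_left (hcont z hz)]

end FredholmDeterminant

section GaussianQuadraticForm

open Matrix WithLp
open scoped RealInnerProductSpace MatrixOrder

lemma sq_integral_exp_neg_mul_sq_gaussianReal {a : ℝ} (ha : 0 < 1 + 2 * a) :
    (∫ x, Real.exp (-(a * x ^ 2)) ∂(gaussianReal 0 1)) ^ 2 * (1 + 2 * a) = 1 := by
  have hdensity : ∀ x : ℝ, gaussianPDFReal 0 1 x • Real.exp (-(a * x ^ 2)) =
      (√(2 * Real.pi))⁻¹ * Real.exp (-(a + 1 / 2) * x ^ 2) := fun x => by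
    rw [gaussianPDFReal, smul_eq_mul, mul_assoc, ← Real.exp_add]
    simp only [NNReal.coe_one, mul_one, sub_zero]
    congr 2
    ring
  have hrate : 0 < a + 1 / 2 := by linarith
  rw [integral_gaussianReal_eq_integral_smul one_ne_zero]
  simp_rw [hdensity]
  rw [integral_const_mul, integral_gaussian, mul_pow, inv_pow, Real.sq_sqrt (by positivity),
    Real.sq_sqrt (by positivity), show 1 + 2 * a = 2 * (a + 1 / 2) by ring]
  field_simp
  exact div_self (by linarith)

variable {ι : Type*} [Fintype ι]

lemma det_one_add_smul_eq_prod_eigenvalues {𝕜 : Type*} [RCLike 𝕜] [DecidableEq ι]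
    {B : Matrix ι ι 𝕜} (hB : B.IsHermitian) (c : 𝕜) :
    (1 + c • B).det = ∏ i, (1 + c * (hB.eigenvalues i : 𝕜)) := by
  conv_lhs => rw [hB.spectral_theorem, Unitary.conjStarAlgAut_apply, ← Matrix.smul_mul,
    det_one_add_mul_comm, Matrix.mul_smul, ← mul_assoc]
  rw [Unitary.coe_star_mul_self, one_mul, ← diagonal_one, ← diagonal_smul, diagonal_add,
    det_diagonal]
  simp

lemma dotProduct_mulVec_sum_smul_eigenvectorBasis [DecidableEq ι] {B : Matrix ι ι ℝ}
    (hB : B.IsHermitian) (c : ι → ℝ) :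
    ofLp (∑ i, c i • hB.eigenvectorBasis i) ⬝ᵥ B *ᵥ ofLp (∑ i, c i • hB.eigenvectorBasis i) =
      ∑ i, hB.eigenvalues i * c i ^ 2 := by
  have heigen : ∀ i, toEuclideanCLM (𝕜 := ℝ) B (hB.eigenvectorBasis i) =
      hB.eigenvalues i • hB.eigenvectorBasis i := fun i => by
    apply ofLp_injective
    rw [ofLp_toEuclideanCLM, hB.mulVec_eigenvectorBasis, ofLp_smul]
  rw [← inner_toEuclideanCLM, map_sum]
  simp_rw [map_smul, heigen, smul_smul]
  rw [hB.eigenvectorBasis.orthonormal.inner_sum]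
  refine Finset.sum_congr rfl fun i _ => ?_
  rw [conj_trivial]
  ring

lemma sq_integral_exp_neg_quadForm_stdGaussian [DecidableEq ι] {B : Matrix ι ι ℝ}
    (hB : B.PosSemidef) :
    (∫ x, Real.exp (-(ofLp x ⬝ᵥ B *ᵥ ofLp x)) ∂(stdGaussian (EuclideanSpace ℝ ι))) ^ 2 *
      (1 + (2 : ℝ) • B).det = 1 := by
  have hherm := hB.isHermitian
  have _ : Continuous fun x : EuclideanSpace ℝ ι => ofLp x := PiLp.continuous_ofLp 2 _
  rw [stdGaussian_eq_map_pi_orthonormalBasis hherm.eigenvectorBasis,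
    integral_map (Measurable.aemeasurable (by fun_prop))
      (Continuous.aestronglyMeasurable (by fun_prop))]
  simp_rw [dotProduct_mulVec_sum_smul_eigenvectorBasis hherm, ← Finset.sum_neg_distrib,
    Real.exp_sum]
  rw [integral_fintype_prod_eq_prod (f := fun i x => Real.exp (-(hherm.eigenvalues i * x ^ 2))),
    det_one_add_smul_eq_prod_eigenvalues hherm, ← Finset.prod_pow, ← Finset.prod_mul_distrib]
  refine Finset.prod_eq_one fun i _ => sq_integral_exp_neg_mul_sq_gaussianReal ?_
  linarith [hB.eigenvalues_nonneg i]

lemma sq_integral_exp_neg_quadForm_multivariateGaussian [DecidableEq ι] {K M : Matrix ι ι ℝ}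
    (hK : K.PosSemidef) (hM : M.PosSemidef) :
    (∫ x, Real.exp (-(ofLp x ⬝ᵥ M *ᵥ ofLp x)) ∂(multivariateGaussian 0 K)) ^ 2 *
      (1 + (2 : ℝ) • (M * K)).det = 1 := by
  set R := CFC.sqrt K with hR
  have hsq : R * R = K := CFC.sqrt_mul_sqrt_self _ hK.nonneg
  have hsymm : Rᵀ = R := by
    rw [← conjTranspose_eq_transpose_of_trivial, ← star_eq_conjTranspose]
    exact (CFC.sqrt_nonneg K).isSelfAdjoint
  have hconj : (R * M * R).PosSemidef := by
    have := hM.mul_mul_conjTranspose_same R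
    rwa [conjTranspose_eq_transpose_of_trivial, hsymm] at this
  have hdet : (1 + (2 : ℝ) • (M * K)).det = (1 + (2 : ℝ) • (R * M * R)).det := by
    rw [← hsq, ← Matrix.mul_assoc, ← Matrix.smul_mul, det_one_add_mul_comm, Matrix.mul_smul,
      Matrix.mul_assoc]
  have _ : Continuous fun x : EuclideanSpace ℝ ι => ofLp x := PiLp.continuous_ofLp 2 _
  rw [hdet, ← sq_integral_exp_neg_quadForm_stdGaussian hconj, multivariateGaussian,
    integral_map (by fun_prop) (Continuous.aestronglyMeasurable (by fun_prop))]
  congr! 5 with x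
  rw [zero_add, ofLp_toEuclideanCLM, ← hR, ← mulVec_mulVec, ← mulVec_mulVec,
    dotProduct_mulVec (ofLp x) R, ← mulVec_transpose, hsymm]

variable {Ω : Type*} [MeasurableSpace Ω] {P : Measure Ω} {X : ι → Ω → ℝ} {K : Matrix ι ι ℝ}

lemma integral_sq_sum_mul (hX : ∀ i, MemLp (X i) 2 P) (hK : ∀ i j, ∫ ω, X i ω * X j ω ∂P = K i j)
    (x : ι → ℝ) : ∫ ω, (∑ i, x i * X i ω) ^ 2 ∂P = x ⬝ᵥ K *ᵥ x := by
  have hint : ∀ i j, Integrable (fun ω => x i * X i ω * (x j * X j ω)) P := fun i j =>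
    ((hX i).const_mul (x i)).integrable_mul ((hX j).const_mul (x j))
  simp_rw [sq, Finset.sum_mul_sum]
  rw [integral_finsetSum _ fun i _ => integrable_finsetSum _ fun j _ => hint i j]
  simp only [dotProduct, mulVec, Finset.mul_sum]
  refine Finset.sum_congr rfl fun i _ => ?_
  rw [integral_finsetSum _ fun j _ => hint i j]
  refine Finset.sum_congr rfl fun j _ => ?_
  rw [← hK, ← integral_mul_const, ← integral_const_mul]
  exact integral_congr_ae (ae_of_all _ fun ω => by ring)

lemma posSemidef_of_integral_mul_eq {ι Ω : Type*} [Finite ι] [MeasurableSpace Ω] {P : Measure Ω}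
    {X : ι → Ω → ℝ} {K : Matrix ι ι ℝ} (hX : ∀ i, MemLp (X i) 2 P)
    (hK : ∀ i j, ∫ ω, X i ω * X j ω ∂P = K i j) : K.PosSemidef := by
  have := Fintype.ofFinite ι
  refine PosSemidef.of_dotProduct_mulVec_nonneg ?_ fun x => ?_
  · ext i j
    rw [conjTranspose_apply, star_trivial, ← hK, ← hK]
    simp_rw [mul_comm]
  · rw [star_trivial, ← integral_sq_sum_mul hX hK]
    positivity

lemma map_eq_multivariateGaussian [DecidableEq ι] (hX : HasGaussianLaw (fun ω i => X i ω) P)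
    (hmean : ∀ i, ∫ ω, X i ω ∂P = 0) (hK : ∀ i j, ∫ ω, X i ω * X j ω ∂P = K i j) :
    P.map (fun ω => toLp 2 fun i => X i ω) = multivariateGaussian 0 K := by
  have hP := hX.isProbabilityMeasure
  have hmemLp : ∀ i, MemLp (X i) 2 P := fun i => (hX.eval i).memLp_two
  apply Measure.ext_of_charFun
  ext t
  have hinner : ∀ ω, ⟪t, toLp 2 fun i => X i ω⟫ = ∑ i, t i * X i ω := fun ω => by
    simp [PiLp.inner_apply, mul_comm]
  have hint : ∀ i ∈ Finset.univ, Integrable (fun ω => t i * X i ω) P := fun i _ =>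
    ((hmemLp i).integrable one_le_two).const_mul _
  have hmean_sum : ∫ ω, ∑ i, t i * X i ω ∂P = 0 := by
    rw [integral_finsetSum _ hint]
    simp [integral_const_mul, hmean]
  have hvar : Var[fun ω => ∑ i, t i * X i ω; P] = ofLp t ⬝ᵥ K *ᵥ ofLp t := by
    rw [variance_of_integral_eq_zero (integrable_finsetSum _ hint).aemeasurable hmean_sum]
    exact integral_sq_sum_mul hmemLp hK _
  rw [charFun_multivariateGaussian (posSemidef_of_integral_mul_eq hmemLp hK),
    (hX.toLp_pi 2).charFun_map_eq]
  simp_rw [hinner]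
  rw [hvar, hmean_sum]
  simp

theorem sq_integral_exp_neg_quadForm [DecidableEq ι] (hX : HasGaussianLaw (fun ω i => X i ω) P)
    (hmean : ∀ i, ∫ ω, X i ω ∂P = 0) (hK : ∀ i j, ∫ ω, X i ω * X j ω ∂P = K i j)
    {M : Matrix ι ι ℝ} (hM : M.PosSemidef) :
    (∫ ω, Real.exp (-((fun i => X i ω) ⬝ᵥ M *ᵥ fun i => X i ω)) ∂P) ^ 2 *
      (1 + (2 : ℝ) • (M * K)).det = 1 := by
  have hKpos := posSemidef_of_integral_mul_eq (fun i => (hX.eval i).memLp_two) hK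
  have _ : Continuous fun x : EuclideanSpace ℝ ι => ofLp x := PiLp.continuous_ofLp 2 _
  rw [← sq_integral_exp_neg_quadForm_multivariateGaussian hKpos hM,
    ← map_eq_multivariateGaussian hX hmean hK,
    integral_map (hX.toLp_pi 2).aemeasurable (Continuous.aestronglyMeasurable (by fun_prop))]

end GaussianQuadraticForm

section AutoregressiveMatrix

open Matrix

section Determinant

variable {R : Type*} [CommRing R]

lemma det_eq_of_row_zero_of_column_zero {n : ℕ} {N : Matrix (Fin (n + 2)) (Fin (n + 2)) R}
    (hrow : ∀ j : Fin n, N 0 j.succ.succ = 0) (hcol : ∀ i : Fin n, N i.succ.succ 0 = 0) :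
    N.det = N 0 0 * (N.submatrix Fin.succ Fin.succ).det -
      N 0 1 * N 1 0 * ((N.submatrix Fin.succ Fin.succ).submatrix Fin.succ Fin.succ).det := by
  have hminor : (N.submatrix Fin.succ (Fin.succAbove 1)).det =
      N 1 0 * ((N.submatrix Fin.succ Fin.succ).submatrix Fin.succ Fin.succ).det := by
    rw [det_succ_column_zero, Fin.sum_univ_succ]
    simp [hcol, Function.comp_def]
  rw [det_succ_row_zero, Fin.sum_univ_succ, Fin.sum_univ_succ]
  simp only [hrow, mul_zero, zero_mul, Finset.sum_const_zero, add_zero, Fin.succ_zero_eq_one,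
    hminor, Fin.succAbove_zero, Fin.val_zero, Fin.val_one, pow_zero, pow_one]
  ring

lemma det_eq_of_row_zero_eq_of_column_zero_eq {n : ℕ} {A : Matrix (Fin (n + 2)) (Fin (n + 2)) R}
    {ρ : R} (hrow : ∀ j : Fin n, A 0 j.succ.succ = ρ * A 1 j.succ.succ)
    (hcol : ∀ i : Fin n, A i.succ.succ 0 = ρ * A i.succ.succ 1) :
    A.det = (A 0 0 - ρ * A 1 0 - ρ * (A 0 1 - ρ * A 1 1)) * (A.submatrix Fin.succ Fin.succ).det -
      (A 0 1 - ρ * A 1 1) * (A 1 0 - ρ * A 1 1) *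
        ((A.submatrix Fin.succ Fin.succ).submatrix Fin.succ Fin.succ).det := by
  set A' := A.updateRow 0 (A 0 + (-ρ) • A 1) with hA'
  set N := A'.updateCol 0 (fun k => A' k 0 + (-ρ) • A' k 1) with hN
  have hdet : N.det = A.det := by
    rw [hN, det_updateCol_add_smul_self _ (by simp), hA', det_updateRow_add_smul_self _ (by simp)]
  have hNrow : ∀ j, j ≠ 0 → N 0 j = A 0 j - ρ * A 1 j := fun j hj => by
    simp [hN, hA', hj, sub_eq_add_neg]
  have hNcol : ∀ i, i ≠ 0 → N i 0 = A i 0 - ρ * A i 1 := fun i hi => by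
    simp [hN, hA', hi, sub_eq_add_neg]
  have hN00 : N 0 0 = A 0 0 - ρ * A 1 0 - ρ * (A 0 1 - ρ * A 1 1) := by
    simp [hN, hA', sub_eq_add_neg]
  have hNsucc : N.submatrix Fin.succ Fin.succ = A.submatrix Fin.succ Fin.succ := by
    ext i j
    simp [hN, hA']
  rw [← hdet, det_eq_of_row_zero_of_column_zero, hN00, hNrow 1 one_ne_zero, hNcol 1 one_ne_zero,
    hNsucc]
  · intro j
    rw [hNrow _ (Fin.succ_ne_zero _), hrow, sub_self]
  · intro i
    rw [hNcol _ (Fin.succ_ne_zero _), hcol, sub_self]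

/-- The correlation matrix `ρ ^ |i - j|` of `n` consecutive values of a stationary autoregressive
process of order one. -/
def arCorrelation (ρ : R) (n : ℕ) : Matrix (Fin n) (Fin n) R :=
  of fun i j => ρ ^ Nat.dist i j

lemma one_add_smul_arCorrelation_submatrix_succ (κ ρ : R) (n : ℕ) :
    (1 + κ • arCorrelation ρ (n + 1)).submatrix Fin.succ Fin.succ = 1 + κ • arCorrelation ρ n := by
  ext i j
  simp [arCorrelation, one_apply, Nat.dist_succ_succ]

lemma det_one_add_smul_arCorrelation_succ_succ (κ ρ : R) (n : ℕ) :
    (1 + κ • arCorrelation ρ (n + 2)).det =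
      (1 + ρ ^ 2 + κ * (1 - ρ ^ 2)) * (1 + κ • arCorrelation ρ (n + 1)).det -
        ρ ^ 2 * (1 + κ • arCorrelation ρ n).det := by
  have hentry : ∀ i j, (1 + κ • arCorrelation ρ (n + 2)) i j =
      (if i = j then 1 else 0) + κ * ρ ^ Nat.dist i j := fun i j => by
    simp [arCorrelation, one_apply]
  have hne : ∀ j : Fin n, (1 : Fin (n + 2)) ≠ j.succ.succ ∧ (0 : Fin (n + 2)) ≠ j.succ.succ :=
    fun j => by simp [Fin.ext_iff]
  rw [det_eq_of_row_zero_eq_of_column_zero_eq (ρ := ρ),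
    one_add_smul_arCorrelation_submatrix_succ, one_add_smul_arCorrelation_submatrix_succ]
  · simp only [hentry, ↓reduceIte, Nat.dist, Fin.val_zero, Fin.val_one, tsub_self, add_zero,
      pow_zero, mul_one, one_ne_zero, tsub_zero, zero_tsub, pow_one, zero_add, zero_ne_one]
    ring
  · intro j
    simp only [hentry, hne j, ↓reduceIte, Nat.dist, Fin.val_zero, Fin.val_one, Fin.val_succ,
      zero_tsub, tsub_zero, zero_add, le_add_iff_nonneg_left, zero_le, Nat.sub_eq_zero_of_le,
      add_tsub_cancel_right]
    ring
  · intro i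
    simp only [hentry, (hne i).1.symm, (hne i).2.symm, ↓reduceIte, Nat.dist, Fin.val_zero,
      Fin.val_one, Fin.val_succ, zero_tsub, tsub_zero, zero_add, add_zero, le_add_iff_nonneg_left,
      zero_le, Nat.sub_eq_zero_of_le, add_tsub_cancel_right]
    ring

lemma sub_mul_det_one_add_smul_arCorrelation {κ ρ u v : R} (hprod : u * v = ρ ^ 2)
    (hsum : u + v = 1 + ρ ^ 2 + κ * (1 - ρ ^ 2)) (n : ℕ) :
    (u - v) * (1 + κ • arCorrelation ρ n).det =
      (1 + κ - v) * u ^ n + (u - 1 - κ) * v ^ n := by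
  induction n using Nat.twoStepInduction with
  | zero =>
    rw [det_fin_zero, pow_zero, pow_zero]
    ring
  | one =>
    simp only [arCorrelation, det_unique, Fin.default_eq_zero, Matrix.add_apply, one_apply_eq,
      Matrix.smul_apply, of_apply, Nat.dist_self, pow_zero, smul_eq_mul, mul_one, pow_one]
    ring
  | more n h0 h1 =>
    rw [det_one_add_smul_arCorrelation_succ_succ, ← hsum, ← hprod]
    linear_combination (u + v) * h1 - u * v * h0

end Determinant

section Centering

variable {ι : Type*} [Fintype ι] [DecidableEq ι]

variable (ι) in
/-- The orthogonal projection onto the vectors of mean zero, which subtracts from every coordinate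
the mean of all coordinates. -/
noncomputable def centering : Matrix ι ι ℝ :=
  1 - (Fintype.card ι : ℝ)⁻¹ • vecMulVec 1 1

lemma dotProduct_centering_mulVec (x : ι → ℝ) :
    x ⬝ᵥ centering ι *ᵥ x = ∑ i, x i ^ 2 - (Fintype.card ι : ℝ)⁻¹ * (∑ i, x i) ^ 2 := by
  rw [centering, sub_mulVec, one_mulVec, smul_mulVec, vecMulVec_mulVec, one_dotProduct,
    dotProduct_sub, dotProduct_smul, dotProduct_smul, dotProduct_one]
  simp only [dotProduct, MulOpposite.smul_eq_mul_unop, MulOpposite.unop_op, smul_eq_mul, sq]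

lemma posSemidef_centering : (centering ι).PosSemidef := by
  refine PosSemidef.of_dotProduct_mulVec_nonneg ?_ fun x => ?_
  · ext i j
    simp [centering, one_apply, eq_comm]
  · rw [star_trivial, dotProduct_centering_mulVec, sub_nonneg]
    cases isEmpty_or_nonempty ι
    · simp
    · rw [inv_mul_le_iff₀ (by exact_mod_cast Fintype.card_pos)]
      exact sq_sum_le_card_mul_sum_sq

lemma mul_det_add_vecMulVec {R : Type*} [CommRing R] {A : Matrix ι ι R} (hA : IsUnit A.det)
    {u f : ι → R} {c : R} (hf : A *ᵥ f = c • u) (v : ι → R) :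
    c * (A + vecMulVec u v).det = A.det * (c + v ⬝ᵥ f) := by
  have hinv : c • (A⁻¹ *ᵥ u) = f := by
    rw [← mulVec_smul, ← hf, mulVec_mulVec, nonsing_inv_mul _ hA, one_mulVec]
  rw [vecMulVec_eq Unit, det_add_replicateCol_mul_replicateRow hA, Matrix.mul_assoc,
    ← replicateCol_mulVec, det_unique (n := Unit), Matrix.add_apply, one_apply_eq,
    replicateRow_mul_replicateCol_apply, ← hinv, dotProduct_smul, smul_eq_mul]
  ring

lemma mul_det_one_add_centering_mul [Nonempty ι] {B : Matrix ι ι ℝ} (hB : IsUnit (1 + B).det)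
    {f : ι → ℝ} {c : ℝ} (hf : (1 + B) *ᵥ f = c • 1) :
    c * (1 + centering ι * B).det = (1 + B).det * ((Fintype.card ι : ℝ)⁻¹ * ∑ i, f i) := by
  have hcard : (Fintype.card ι : ℝ) ≠ 0 := by exact_mod_cast Fintype.card_ne_zero
  have hrank_one : 1 + centering ι * B =
      (1 + B) + vecMulVec 1 (-(Fintype.card ι : ℝ)⁻¹ • (1 ᵥ* B)) := by
    rw [centering, sub_mul, one_mul, smul_mul, vecMulVec_mul, vecMulVec_smul, neg_smul]
    abel
  have hBf : B *ᵥ f = c • 1 - f := by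
    rw [← hf, add_mulVec, one_mulVec, add_sub_cancel_left]
  have hsum : ∑ i, (c • (1 : ι → ℝ) - f) i = Fintype.card ι * c - ∑ i, f i := by
    simp
  rw [hrank_one, mul_det_add_vecMulVec hB hf, smul_dotProduct, ← dotProduct_mulVec, hBf,
    one_dotProduct, hsum, smul_eq_mul, neg_mul, mul_sub, inv_mul_cancel_left₀ hcard]
  ring

end Centering

section LinearSystem

lemma sum_arCorrelation_mul_pow {R : Type*} [CommRing R] (ρ x : R) {n : ℕ} (i : Fin n) :
    (x - ρ) * (1 - ρ * x) * ∑ j, arCorrelation ρ n i j * x ^ (j : ℕ) =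
      x ^ ((i : ℕ) + 1) * (1 - ρ ^ 2) - ρ ^ ((i : ℕ) + 1) * (1 - ρ * x) -
        ρ ^ (n - i) * x ^ n * (x - ρ) := by
  obtain ⟨k, hk⟩ := i
  obtain ⟨m, rfl⟩ := Nat.exists_eq_add_of_lt hk
  simp only [arCorrelation, of_apply]
  rw [Fin.sum_univ_eq_sum_range fun j => ρ ^ Nat.dist k j * x ^ j, add_assoc,
    Finset.sum_range_add, Nat.add_sub_cancel_left]
  have hleft : ∑ j ∈ Finset.range k, ρ ^ Nat.dist k j * x ^ j =
      ρ * ∑ j ∈ Finset.range k, x ^ j * ρ ^ (k - 1 - j) := by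
    rw [Finset.mul_sum]
    refine Finset.sum_congr rfl fun j hj => ?_
    rw [Finset.mem_range] at hj
    rw [Nat.dist_eq_sub_of_le_right hj.le, show k - j = k - 1 - j + 1 by lia]
    ring
  have hright : ∑ j ∈ Finset.range (m + 1), ρ ^ Nat.dist k (k + j) * x ^ (k + j) =
      x ^ k * ∑ j ∈ Finset.range (m + 1), (ρ * x) ^ j := by
    rw [Finset.mul_sum]
    refine Finset.sum_congr rfl fun j _ => ?_
    rw [Nat.dist_eq_sub_of_le (Nat.le_add_right k j), Nat.add_sub_cancel_left]
    ring
  have hgeom_left : (∑ j ∈ Finset.range k, x ^ j * ρ ^ (k - 1 - j)) * (x - ρ) = x ^ k - ρ ^ k :=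
    (Commute.all x ρ).geom_sum₂_mul k
  have hgeom_right := geom_sum_mul (ρ * x) (m + 1)
  rw [mul_pow] at hgeom_right
  rw [hleft, hright]
  linear_combination ρ * (1 - ρ * x) * hgeom_left - x ^ k * (x - ρ) * hgeom_right

variable {𝕜 : Type*} [Field 𝕜] {κ ρ x : 𝕜} {n : ℕ}

lemma one_add_smul_arCorrelation_mulVec_pow (hxρ : x ≠ ρ) (hρx : ρ * x ≠ 1)
    (hκ : κ * (x * (1 - ρ ^ 2)) = (x - ρ) * (ρ * x - 1)) :
    (1 + κ • arCorrelation ρ n) *ᵥ (fun j : Fin n => x ^ (j : ℕ)) = fun i : Fin n =>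
      -κ * (ρ ^ ((i : ℕ) + 1) / (x - ρ) + ρ ^ (n - i) * x ^ n / (1 - ρ * x)) := by
  have hxρ' : x - ρ ≠ 0 := sub_ne_zero.2 hxρ
  have hρx' : 1 - x * ρ ≠ 0 := sub_ne_zero.2 (mul_comm ρ x ▸ hρx.symm)
  ext i
  have hsum := sum_arCorrelation_mul_pow ρ x i
  rw [add_mulVec, one_mulVec, smul_mulVec, Pi.add_apply, Pi.smul_apply, smul_eq_mul]
  simp only [mulVec, dotProduct]
  field_simp
  linear_combination κ * hsum + x ^ (i : ℕ) * hκ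

lemma one_add_smul_arCorrelation_mulVec_one (hρ : ρ ≠ 1) :
    (1 + κ • arCorrelation ρ n) *ᵥ 1 = fun i : Fin n =>
      1 + κ * ((1 + ρ) / (1 - ρ)) -
        κ / (1 - ρ) * (ρ ^ ((i : ℕ) + 1) + ρ ^ (n - i)) := by
  have hρ' : 1 - ρ ≠ 0 := sub_ne_zero.2 hρ.symm
  ext i
  have hsum := sum_arCorrelation_mul_pow ρ 1 i
  simp only [one_pow, mul_one, one_mul] at hsum
  rw [add_mulVec, one_mulVec, smul_mulVec, Pi.add_apply, Pi.smul_apply, smul_eq_mul, Pi.one_apply]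
  simp only [mulVec, dotProduct_one]
  field_simp
  refine mul_left_cancel₀ hρ' ?_
  linear_combination κ * hsum

lemma one_add_smul_arCorrelation_mulVec_pow_add_pow_rev (hx : x ≠ 0) (hxρ : x ≠ ρ)
    (hρx : ρ * x ≠ 1) (hκ : κ * (x * (1 - ρ ^ 2)) = (x - ρ) * (ρ * x - 1)) :
    (1 + κ • arCorrelation ρ n) *ᵥ (fun j : Fin n => x ^ (j : ℕ) + x ^ (n - 1 - j)) =
      fun i : Fin n => -κ * (1 / (x - ρ) + x ^ n / (1 - ρ * x)) *
        (ρ ^ ((i : ℕ) + 1) + ρ ^ (n - i)) := by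
  have hxρ' : x - ρ ≠ 0 := sub_ne_zero.2 hxρ
  have hρx' : 1 - x * ρ ≠ 0 := sub_ne_zero.2 (mul_comm ρ x ▸ hρx.symm)
  have hinv := one_add_smul_arCorrelation_mulVec_pow (κ := κ) (ρ := ρ) (x := x⁻¹) (n := n)
    (fun h => hρx (by rw [← h, inv_mul_cancel₀ hx]))
    (fun h => hxρ (by rw [← mul_inv_cancel_right₀ hx ρ, mul_right_comm, h, one_mul]))
    (by field_simp; linear_combination hκ)
  have hrev : (fun j : Fin n => x ^ (j : ℕ) + x ^ (n - 1 - j)) =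
      (fun j : Fin n => x ^ (j : ℕ)) + (x ^ n * x⁻¹) • fun j : Fin n => x⁻¹ ^ (j : ℕ) := by
    ext j
    rw [Nat.sub_sub, pow_sub₀ x hx (by lia)]
    simp only [Pi.add_apply, Pi.smul_apply, smul_eq_mul, pow_add, pow_one, mul_inv, inv_pow,
      mul_assoc]
  rw [hrev, mulVec_add, mulVec_smul, one_add_smul_arCorrelation_mulVec_pow hxρ hρx hκ, hinv]
  ext i
  simp only [Pi.add_apply, Pi.smul_apply, smul_eq_mul, inv_pow]
  field_simp
  ring

lemma one_add_smul_arCorrelation_mulVec_eq_smul_one (hx : x ≠ 0) (hρ : ρ ≠ 1) (hxρ : x ≠ ρ)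
    (hρx : ρ * x ≠ 1) (hκ : κ * (x * (1 - ρ ^ 2)) = (x - ρ) * (ρ * x - 1)) {w : 𝕜} (hw0 : w ≠ 0)
    (hw : w = (1 - ρ) * (1 / (x - ρ) + x ^ n / (1 - ρ * x))) :
    (1 + κ • arCorrelation ρ n) *ᵥ (fun j : Fin n => 1 - (x ^ (j : ℕ) + x ^ (n - 1 - j)) / w) =
      (1 + κ * ((1 + ρ) / (1 - ρ))) • 1 := by
  have hρ' : 1 - ρ ≠ 0 := sub_ne_zero.2 hρ.symm
  have hsplit : (fun j : Fin n => 1 - (x ^ (j : ℕ) + x ^ (n - 1 - j)) / w) =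
      1 - w⁻¹ • fun j : Fin n => x ^ (j : ℕ) + x ^ (n - 1 - j) := by
    ext
    simp [div_eq_inv_mul]
  have hbracket : 1 / (x - ρ) + x ^ n / (1 - ρ * x) = w / (1 - ρ) := by
    rw [hw, mul_div_cancel_left₀ _ hρ']
  rw [hsplit, mulVec_sub, mulVec_smul, one_add_smul_arCorrelation_mulVec_one hρ,
    one_add_smul_arCorrelation_mulVec_pow_add_pow_rev hx hxρ hρx hκ, hbracket]
  ext i
  simp only [Pi.sub_apply, Pi.smul_apply, Pi.one_apply, smul_eq_mul]
  field_simp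
  ring

lemma sum_one_sub_pow_add_pow_rev_div (hx1 : x ≠ 1) (w : 𝕜) :
    ∑ j : Fin n, (1 - (x ^ (j : ℕ) + x ^ (n - 1 - j)) / w) =
      n - 2 * ((x ^ n - 1) / (x - 1)) / w := by
  rw [Fin.sum_univ_eq_sum_range fun j => 1 - (x ^ j + x ^ (n - 1 - j)) / w,
    Finset.sum_sub_distrib, ← Finset.sum_div, Finset.sum_add_distrib,
    Finset.sum_range_reflect (fun j => x ^ j), geom_sum_eq hx1, ← two_mul]
  simp

end LinearSystem

section Limit

lemma tendsto_nat_mul_exp_div_sub_exp_div (a b : ℝ) :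
    Tendsto (fun n : ℕ => (n : ℝ) * (Real.exp (a / n) - Real.exp (b / n))) atTop (𝓝 (a - b)) := by
  have hderiv : HasDerivAt (fun t : ℝ => Real.exp (a * t) - Real.exp (b * t)) (a - b) 0 := by
    simpa using (((hasDerivAt_id (0 : ℝ)).const_mul a).exp).fun_sub
      (((hasDerivAt_id (0 : ℝ)).const_mul b).exp)
  have hinv : Tendsto (fun n : ℕ => (n : ℝ)⁻¹) atTop (𝓝[≠] 0) := by
    refine tendsto_nhdsWithin_iff.2 ⟨tendsto_inv_atTop_nhds_zero_nat, ?_⟩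
    filter_upwards [eventually_ne_atTop 0] with n hn
    simpa using hn
  refine (hderiv.tendsto_slope_zero.comp hinv).congr fun n => ?_
  simp [div_eq_mul_inv]

lemma tendsto_exp_div_nat (c : ℝ) : Tendsto (fun n : ℕ => Real.exp (c / n)) atTop (𝓝 1) := by
  rw [← Real.exp_zero]
  exact (Real.continuous_exp.tendsto 0).comp (tendsto_const_div_atTop_nhds_zero_nat c)

lemma exp_div_nat_pow {n : ℕ} (hn : n ≠ 0) (c : ℝ) : Real.exp (c / n) ^ n = Real.exp c := by
  rw [← Real.exp_nat_mul, mul_div_cancel₀ _ (Nat.cast_ne_zero.2 hn)]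

/-- The weight `κ` on the grid with `n` points for which the determinant of `1 + κ • ρ ^ |i - j|`,
`ρ = exp (-β / n)`, has characteristic roots `ρ * exp (± γ / n)`. It is asymptotic to
`(γ ^ 2 - β ^ 2) / (2 * β * n)`. -/
noncomputable def gridWeight (β γ : ℝ) (n : ℕ) : ℝ :=
  (Real.cosh (γ / n) - Real.cosh (β / n)) / Real.sinh (β / n)

variable {β γ : ℝ}

lemma gridWeight_nonneg (hβ : 0 ≤ β) (hγ : β ≤ γ) (n : ℕ) : 0 ≤ gridWeight β γ n := by
  refine div_nonneg (sub_nonneg.2 (Real.cosh_le_cosh.2 ?_)) (Real.sinh_nonneg_iff.2 (by positivity))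
  rw [abs_of_nonneg (by positivity), abs_of_nonneg (div_nonneg (hβ.trans hγ) n.cast_nonneg)]
  gcongr

lemma gridWeight_mul (hβ : β ≠ 0) (γ : ℝ) {n : ℕ} (hn : n ≠ 0) :
    gridWeight β γ n * (Real.exp (γ / n) * (1 - Real.exp (-β / n) ^ 2)) =
      (Real.exp (γ / n) - Real.exp (-β / n)) * (Real.exp (-β / n) * Real.exp (γ / n) - 1) := by
  have hsinh : Real.sinh (β / n) ≠ 0 :=
    Real.sinh_ne_zero.2 (div_ne_zero hβ (Nat.cast_ne_zero.2 hn))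
  have hfactor : 1 - Real.exp (-β / n) ^ 2 = 2 * Real.exp (-β / n) * Real.sinh (β / n) := by
    rw [Real.sinh_eq, neg_div, Real.exp_neg]
    field_simp
  rw [hfactor, gridWeight, Real.cosh_eq, Real.cosh_eq, neg_div, Real.exp_neg, Real.exp_neg]
  field_simp
  ring

lemma tendsto_nat_mul_gridWeight (hβ : β ≠ 0) (γ : ℝ) :
    Tendsto (fun n : ℕ => (n : ℝ) * gridWeight β γ n) atTop
      (𝓝 ((γ ^ 2 - β ^ 2) / (2 * β))) := by
  have hne : (1 : ℝ) * (0 - (-β + -β)) ≠ 0 := fun h => hβ (by linarith)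
  have hsub := tendsto_nat_mul_exp_div_sub_exp_div γ (-β)
  have hmul := tendsto_nat_mul_exp_div_sub_exp_div (γ - β) 0
  have hden := (tendsto_exp_div_nat γ).mul (tendsto_nat_mul_exp_div_sub_exp_div 0 (-β + -β))
  have hlim := (hsub.mul hmul).div hden hne
  rw [show (γ - -β) * (γ - β - 0) / (1 * (0 - (-β + -β))) = (γ ^ 2 - β ^ 2) / (2 * β) by
    field_simp; ring] at hlim
  refine hlim.congr' ?_
  filter_upwards [eventually_ne_atTop 0, hden.eventually_ne hne] with n hn hne
  have hκ := gridWeight_mul hβ γ hn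
  rw [Pi.div_apply, div_eq_iff hne]
  simp only [sub_eq_neg_add, add_div, Real.exp_add, zero_div, Real.exp_zero] at hκ ⊢
  linear_combination (-n ^ 2 : ℝ) * hκ

lemma tendsto_det_one_add_gridWeight_smul (hβ : β ≠ 0) (hγ : γ ≠ 0) :
    Tendsto (fun n : ℕ => (1 + gridWeight β γ n • arCorrelation (Real.exp (-β / n)) n).det) atTop
      (𝓝 (Real.exp (-β) * ((γ + β) ^ 2 * Real.exp γ - (γ - β) ^ 2 * Real.exp (-γ)) /
        (4 * β * γ))) := by
  have hroots : γ - β - (-γ - β) ≠ 0 := fun h => hγ (by linarith)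
  have hκ := tendsto_nat_mul_gridWeight hβ γ
  have hdiff := tendsto_nat_mul_exp_div_sub_exp_div (γ - β) (-γ - β)
  have hu := tendsto_nat_mul_exp_div_sub_exp_div (γ - β) 0
  have hv := tendsto_nat_mul_exp_div_sub_exp_div 0 (-γ - β)
  have hlim := (((hκ.add hv).mul_const (Real.exp (γ - β))).add
    ((hu.sub hκ).mul_const (Real.exp (-γ - β)))).div hdiff hroots
  convert hlim.congr' ?_ using 2
  · rw [show γ - β - (-γ - β) = 2 * γ by ring, sub_eq_neg_add γ, sub_eq_neg_add (-γ),
      Real.exp_add, Real.exp_add]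
    field_simp
    ring
  filter_upwards [eventually_ne_atTop 0, hdiff.eventually_ne hroots] with n hn hne
  have hprod : Real.exp ((γ - β) / n) * Real.exp ((-γ - β) / n) = Real.exp (-β / n) ^ 2 := by
    rw [← Real.exp_add, ← Real.exp_nat_mul]
    congr 1
    push_cast
    ring
  have hsum : Real.exp ((γ - β) / n) + Real.exp ((-γ - β) / n) = 1 + Real.exp (-β / n) ^ 2 +
      gridWeight β γ n * (1 - Real.exp (-β / n) ^ 2) := by
    have hweight := gridWeight_mul hβ γ hn
    simp only [sub_eq_neg_add, add_div, Real.exp_add, neg_div, Real.exp_neg] at hweight ⊢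
    field_simp at hweight ⊢
    linear_combination -hweight
  have hdet := sub_mul_det_one_add_smul_arCorrelation hprod hsum n
  rw [exp_div_nat_pow hn, exp_div_nat_pow hn] at hdet
  rw [Pi.div_apply, div_eq_iff hne, zero_div, Real.exp_zero]
  linear_combination (-n : ℝ) * hdet

lemma tendsto_autoregressive_shift (hsum : γ + β ≠ 0) (hdiff : β - γ ≠ 0) :
    Tendsto (fun n : ℕ => (1 - Real.exp (-β / n)) * (1 / (Real.exp (γ / n) - Real.exp (-β / n)) +
      Real.exp (γ / n) ^ n / (1 - Real.exp (-β / n) * Real.exp (γ / n)))) atTop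
      (𝓝 (β * (1 / (γ + β) + Real.exp γ / (β - γ)))) := by
  have hβ := tendsto_nat_mul_exp_div_sub_exp_div 0 (-β)
  have hγ := tendsto_nat_mul_exp_div_sub_exp_div γ (-β)
  have hprod := tendsto_nat_mul_exp_div_sub_exp_div 0 (-β + γ)
  rw [sub_neg_eq_add] at hγ
  rw [show 0 - (-β + γ) = β - γ by ring] at hprod
  have hlim := hβ.mul ((hγ.inv₀ hsum).add ((hprod.inv₀ hdiff).const_mul (Real.exp γ)))
  convert hlim.congr' ?_ using 2
  · ring
  filter_upwards [eventually_ne_atTop 0] with n hn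
  have hn' : (n : ℝ) ≠ 0 := Nat.cast_ne_zero.2 hn
  rw [exp_div_nat_pow hn, zero_div, Real.exp_zero, add_div, Real.exp_add, mul_inv, mul_inv]
  field_simp

lemma tendsto_inv_mul_sum_one_sub_pow (hγ : γ ≠ 0) {w : ℕ → ℝ} {W : ℝ} (hW : W ≠ 0)
    (hw : Tendsto w atTop (𝓝 W)) :
    Tendsto (fun n : ℕ => (n : ℝ)⁻¹ * ∑ j : Fin n,
      (1 - (Real.exp (γ / n) ^ (j : ℕ) + Real.exp (γ / n) ^ (n - 1 - (j : ℕ))) / w n)) atTop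
      (𝓝 (1 - 2 * (Real.exp γ - 1) / γ / W)) := by
  have hden := tendsto_nat_mul_exp_div_sub_exp_div γ 0
  rw [sub_zero] at hden
  have hlim := (((hden.inv₀ hγ).const_mul (2 * (Real.exp γ - 1))).mul (hw.inv₀ hW)).const_sub 1
  simp only [← div_eq_mul_inv] at hlim
  refine hlim.congr' ?_
  filter_upwards [eventually_ne_atTop 0] with n hn
  have hn' : (n : ℝ) ≠ 0 := Nat.cast_ne_zero.2 hn
  have hx : Real.exp (γ / n) ≠ 1 := by simp [hγ, hn]
  rw [sum_one_sub_pow_add_pow_rev_div hx, exp_div_nat_pow hn, zero_div, Real.exp_zero]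
  field_simp

lemma tendsto_one_add_gridWeight_mul (hβ : β ≠ 0) (γ : ℝ) :
    Tendsto (fun n : ℕ => 1 + gridWeight β γ n *
      ((1 + Real.exp (-β / n)) / (1 - Real.exp (-β / n)))) atTop (𝓝 (γ ^ 2 / β ^ 2)) := by
  have hden := tendsto_nat_mul_exp_div_sub_exp_div 0 (-β)
  rw [zero_sub, neg_neg] at hden
  have hlim := ((tendsto_nat_mul_gridWeight hβ γ).mul
    (((tendsto_exp_div_nat (-β)).const_add 1).mul (hden.inv₀ hβ))).const_add 1
  convert hlim.congr' ?_ using 2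
  · field_simp
    ring
  filter_upwards [eventually_ne_atTop 0] with n hn
  have hn' : (n : ℝ) ≠ 0 := Nat.cast_ne_zero.2 hn
  rw [zero_div, Real.exp_zero, mul_inv]
  field_simp

lemma inv_add_exp_div_ne_zero (hβ : 0 < β) (hγ : β < γ) :
    1 / (γ + β) + Real.exp γ / (β - γ) ≠ 0 := by
  have hγ₀ : 0 < γ := hβ.trans hγ
  have hsum : γ + β ≠ 0 := by positivity
  have hdiff : β - γ ≠ 0 := (sub_neg.2 hγ).ne
  rw [div_add_div _ _ hsum hdiff]
  refine div_ne_zero ?_ (mul_ne_zero hsum hdiff)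
  nlinarith [Real.one_lt_exp_iff.2 hγ₀]

lemma exp_mul_sq_mul_exp_sub_pos (hβ : 0 < β) (hγ : 0 < γ) :
    0 < Real.exp (-β) * ((γ + β) ^ 2 * Real.exp γ - (γ - β) ^ 2 * Real.exp (-γ)) /
      (4 * β * γ) := by
  have hexp : Real.exp (-γ) < Real.exp γ := Real.exp_lt_exp.2 (by linarith)
  have hsq : (γ - β) ^ 2 ≤ (γ + β) ^ 2 := by nlinarith
  have hlt : (γ - β) ^ 2 * Real.exp (-γ) < (γ + β) ^ 2 * Real.exp γ :=
    (mul_le_mul_of_nonneg_right hsq (Real.exp_pos _).le).trans_lt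
      (mul_lt_mul_of_pos_left hexp (by positivity))
  have := sub_pos.2 hlt
  positivity

lemma mul_div_eq_fredholmDetReal (hβ : 0 < β) (hγ : β < γ) :
    Real.exp (-β) * ((γ + β) ^ 2 * Real.exp γ - (γ - β) ^ 2 * Real.exp (-γ)) / (4 * β * γ) *
      (1 - 2 * (Real.exp γ - 1) / γ / (β * (1 / (γ + β) + Real.exp γ / (β - γ)))) /
      (γ ^ 2 / β ^ 2) = fredholmDetReal β γ := by
  have hγ₀ : 0 < γ := hβ.trans hγ
  have hsum : γ + β ≠ 0 := by positivity
  have hdiff : β - γ ≠ 0 := (sub_neg.2 hγ).ne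
  have hE : Real.exp γ = Real.exp (γ / 2) ^ 2 := by
    rw [← Real.exp_nat_mul]
    congr 1
    push_cast
    ring
  have hE_gt : 1 < Real.exp (γ / 2) := Real.one_lt_exp_iff.2 (by positivity)
  rw [fredholmDetReal, Real.cosh_eq, Real.sinh_eq, Real.exp_neg γ, Real.exp_neg (γ / 2), hE]
  generalize Real.exp (γ / 2) = E at *
  have hE₀ : E ≠ 0 := by positivity
  have hpos : β - γ + E ^ 2 * (γ + β) ≠ 0 := by
    nlinarith [one_lt_pow₀ hE_gt two_ne_zero]
  have hshift : 1 / (γ + β) + E ^ 2 / (β - γ) =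
      (β - γ + E ^ 2 * (γ + β)) / ((γ + β) * (β - γ)) := by
    field_simp
  have hfactor : (γ + β) ^ 2 * E ^ 2 - (γ - β) ^ 2 * (E ^ 2)⁻¹ =
      (β - γ + E ^ 2 * (γ + β)) * (γ - β + E ^ 2 * (γ + β)) / E ^ 2 := by
    field_simp
    ring
  rw [hshift, hfactor]
  field_simp
  ring

lemma tendsto_det_one_add_centering_mul (hβ : 0 < β) (hγ : β < γ) :
    Tendsto (fun n : ℕ => (1 + centering (Fin n) *
      gridWeight β γ n • arCorrelation (Real.exp (-β / n)) n).det) atTop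
      (𝓝 (fredholmDetReal β γ)) := by
  have hγ₀ : 0 < γ := hβ.trans hγ
  have hsum : γ + β ≠ 0 := by positivity
  have hdiff : β - γ ≠ 0 := (sub_neg.2 hγ).ne
  have hshift := tendsto_autoregressive_shift hsum hdiff
  have hW : β * (1 / (γ + β) + Real.exp γ / (β - γ)) ≠ 0 :=
    mul_ne_zero hβ.ne' (inv_add_exp_div_ne_zero hβ hγ)
  have hdet := tendsto_det_one_add_gridWeight_smul hβ.ne' hγ₀.ne'
  have hdet_ne := (exp_mul_sq_mul_exp_sub_pos hβ hγ₀).ne'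
  have hrow := tendsto_one_add_gridWeight_mul hβ.ne' γ
  have hrow_ne : γ ^ 2 / β ^ 2 ≠ 0 := by positivity
  have hlim := (hdet.mul (tendsto_inv_mul_sum_one_sub_pow hγ₀.ne' hW hshift)).div hrow hrow_ne
  rw [mul_div_eq_fredholmDetReal hβ hγ] at hlim
  refine hlim.congr' ?_
  filter_upwards [eventually_ne_atTop 0, hshift.eventually_ne hW, hdet.eventually_ne hdet_ne,
    hrow.eventually_ne hrow_ne] with n hn hw hD hA
  have : NeZero n := ⟨hn⟩
  have hn₀ : (0 : ℝ) < n := by positivity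
  have hρ : Real.exp (-β / n) < 1 :=
    Real.exp_lt_one_iff.2 (div_neg_of_neg_of_pos (neg_neg_of_pos hβ) hn₀)
  have hx : 1 < Real.exp (γ / n) := Real.one_lt_exp_iff.2 (div_pos hγ₀ hn₀)
  have hρx : Real.exp (-β / n) * Real.exp (γ / n) ≠ 1 := by
    rw [← Real.exp_add, ← add_div, Ne, Real.exp_eq_one_iff]
    exact div_ne_zero (by linarith) hn₀.ne'
  have hsolve := one_add_smul_arCorrelation_mulVec_eq_smul_one (Real.exp_pos _).ne' hρ.ne
    (hρ.trans hx).ne' hρx (gridWeight_mul hβ.ne' γ hn) hw rfl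
  have hcenter := mul_det_one_add_centering_mul hD.isUnit hsolve
  rw [Fintype.card_fin] at hcenter
  rw [Pi.div_apply, div_eq_iff hA, ← hcenter, mul_comm]

end Limit

end AutoregressiveMatrix

section Variance

section

variable {Ω : Type*} [MeasurableSpace Ω] {P : Measure Ω} {X Y : Ω → ℝ}

lemma abs_covariance_le [IsFiniteMeasure P] (hX : MemLp X 2 P) (hY : MemLp Y 2 P) {c : ℝ}
    (hc : 0 < c) :
    |cov[X, Y; P]| ≤ c / 2 * Var[X; P] + (2 * c)⁻¹ * Var[Y; P] := by
  have hadd := variance_nonneg (fun ω => c * X ω + Y ω) P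
  have hsub := variance_nonneg (fun ω => c * X ω - Y ω) P
  rw [variance_fun_add (hX.const_mul c) hY, variance_const_mul, covariance_const_mul_left] at hadd
  rw [variance_fun_sub (hX.const_mul c) hY, variance_const_mul, covariance_const_mul_left] at hsub
  have hscale : c / 2 * Var[X; P] + (2 * c)⁻¹ * Var[Y; P] =
      (c ^ 2 * Var[X; P] + Var[Y; P]) / (2 * c) := by
    field_simp
  rw [hscale, le_div_iff₀ (by positivity), ← abs_of_pos (by positivity : 0 < 2 * c), ← abs_mul,
    abs_le]
  constructor <;> linarith

lemma abs_variance_sub_variance_le [IsProbabilityMeasure P] (hX : MemLp X 2 P) (hY : MemLp Y 2 P)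
    {c : ℝ} (hc : 0 < c) :
    |Var[X; P] - Var[Y; P]| ≤ c / 2 * ∫ ω, (X ω - Y ω) ^ 2 ∂P +
      c⁻¹ * (∫ ω, X ω ^ 2 ∂P + ∫ ω, Y ω ^ 2 ∂P) := by
  have hpolar : Var[X; P] - Var[Y; P] = cov[X - Y, X + Y; P] := by
    rw [covariance_sub_left hX hY (hX.add hY), covariance_add_right hX hX hY,
      covariance_add_right hY hX hY, covariance_self hX.aemeasurable,
      covariance_self hY.aemeasurable, covariance_comm Y X]
    ring
  have hdiff : Var[X - Y; P] ≤ ∫ ω, (X ω - Y ω) ^ 2 ∂P :=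
    variance_le_expectation_sq (hX.sub hY).aestronglyMeasurable
  have hsum : Var[X + Y; P] ≤ 2 * (∫ ω, X ω ^ 2 ∂P + ∫ ω, Y ω ^ 2 ∂P) := by
    refine (variance_le_expectation_sq (hX.add hY).aestronglyMeasurable).trans ?_
    rw [← integral_add hX.integrable_sq hY.integrable_sq, ← integral_const_mul]
    exact integral_mono (hX.add hY).integrable_sq
      ((hX.integrable_sq.add hY.integrable_sq).const_mul 2) fun ω => add_sq_le
  rw [hpolar]
  calc |cov[X - Y, X + Y; P]|
      ≤ c / 2 * Var[X - Y; P] + (2 * c)⁻¹ * Var[X + Y; P] :=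
        abs_covariance_le (hX.sub hY) (hX.add hY) hc
    _ ≤ c / 2 * ∫ ω, (X ω - Y ω) ^ 2 ∂P +
          (2 * c)⁻¹ * (2 * (∫ ω, X ω ^ 2 ∂P + ∫ ω, Y ω ^ 2 ∂P)) := by gcongr
    _ = _ := by
        field_simp

end

section

variable {α Ω : Type*} [MeasurableSpace α] [MeasurableSpace Ω] {μ : Measure α} {P : Measure Ω}
  {V W : α → Ω → ℝ}

lemma memLp_two_uncurry [IsFiniteMeasure μ] [SFinite P]
    (hm : AEMeasurable (Function.uncurry V) (μ.prod P)) (hV : ∀ t, MemLp (V t) 2 P) {C : ℝ}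
    (hC : ∀ t, ∫ ω, V t ω ^ 2 ∂P ≤ C) : MemLp (Function.uncurry V) 2 (μ.prod P) := by
  have hsq := (hm.pow_const 2).aestronglyMeasurable
  rw [memLp_two_iff_integrable_sq hm.aestronglyMeasurable, integrable_prod_iff hsq]
  refine ⟨Eventually.of_forall fun t => (hV t).integrable_sq, ?_⟩
  refine (integrable_const C).mono' hsq.norm.integral_prod_right' (Eventually.of_forall fun t => ?_)
  simp only [Function.uncurry_apply_pair, norm_pow, Real.norm_eq_abs, sq_abs]
  rw [abs_of_nonneg (integral_nonneg fun ω => sq_nonneg _)]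
  exact hC t

lemma memLp_two_path [SFinite μ] [SFinite P] (hV : MemLp (Function.uncurry V) 2 (μ.prod P)) :
    ∀ᵐ ω ∂P, MemLp (fun t => V t ω) 2 μ := by
  filter_upwards [hV.aestronglyMeasurable.prodMk_right, hV.integrable_sq.prod_left_ae]
    with ω hm hsq
  exact (memLp_two_iff_integrable_sq hm).2 hsq

variable [IsProbabilityMeasure μ]

lemma integrable_variance_path [IsFiniteMeasure P]
    (hV : MemLp (Function.uncurry V) 2 (μ.prod P)) :
    Integrable (fun ω => Var[fun t => V t ω; μ]) P := by
  have hsq : Integrable (fun ω => ∫ t, V t ω ^ 2 ∂μ) P := hV.integrable_sq.integral_prod_right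
  have hmean : Integrable (fun ω => ∫ t, V t ω ∂μ) P :=
    (hV.integrable one_le_two).integral_prod_right
  have hvar : (fun ω => (∫ t, V t ω ^ 2 ∂μ) - (∫ t, V t ω ∂μ) ^ 2) =ᵐ[P]
      fun ω => Var[fun t => V t ω; μ] := by
    filter_upwards [memLp_two_path hV] with ω hω
    exact (variance_eq_sub hω).symm
  refine hsq.mono' ((hsq.aestronglyMeasurable.sub (hmean.aestronglyMeasurable.pow 2)).congr hvar) ?_
  filter_upwards [memLp_two_path hV] with ω hω
  rw [Real.norm_of_nonneg (variance_nonneg _ _)]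
  exact variance_le_expectation_sq hω.aestronglyMeasurable

lemma integral_abs_variance_path_sub_le [IsFiniteMeasure P]
    (hV : MemLp (Function.uncurry V) 2 (μ.prod P)) (hW : MemLp (Function.uncurry W) 2 (μ.prod P))
    {c : ℝ} (hc : 0 < c) :
    ∫ ω, |Var[fun t => V t ω; μ] - Var[fun t => W t ω; μ]| ∂P ≤
      c / 2 * ∫ t, ∫ ω, (V t ω - W t ω) ^ 2 ∂P ∂μ +
        c⁻¹ * (∫ t, ∫ ω, V t ω ^ 2 ∂P ∂μ + ∫ t, ∫ ω, W t ω ^ 2 ∂P ∂μ) := by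
  have hVW : MemLp (Function.uncurry fun t ω => V t ω - W t ω) 2 (μ.prod P) := hV.sub hW
  have hdiff : Integrable (fun ω => c / 2 * ∫ t, (V t ω - W t ω) ^ 2 ∂μ) P :=
    hVW.integrable_sq.integral_prod_right.const_mul _
  have hsq : Integrable (fun ω => ∫ t, V t ω ^ 2 ∂μ) P := hV.integrable_sq.integral_prod_right
  have hsq' : Integrable (fun ω => ∫ t, W t ω ^ 2 ∂μ) P := hW.integrable_sq.integral_prod_right
  have hsum : Integrable (fun ω => c⁻¹ * (∫ t, V t ω ^ 2 ∂μ + ∫ t, W t ω ^ 2 ∂μ)) P :=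
    (hsq.add hsq').const_mul _
  have hle : ∀ᵐ ω ∂P, |Var[fun t => V t ω; μ] - Var[fun t => W t ω; μ]| ≤
      c / 2 * ∫ t, (V t ω - W t ω) ^ 2 ∂μ +
        c⁻¹ * (∫ t, V t ω ^ 2 ∂μ + ∫ t, W t ω ^ 2 ∂μ) := by
    filter_upwards [memLp_two_path hV, memLp_two_path hW] with ω hVω hWω
    exact abs_variance_sub_variance_le hVω hWω hc
  have hswap {Z : α → Ω → ℝ} (hZ : MemLp (Function.uncurry Z) 2 (μ.prod P)) :
      ∫ t, ∫ ω, Z t ω ^ 2 ∂P ∂μ = ∫ ω, ∫ t, Z t ω ^ 2 ∂μ ∂P :=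
    integral_integral_swap hZ.integrable_sq
  rw [hswap hVW, hswap hV, hswap hW, ← integral_add hsq hsq', ← integral_const_mul,
    ← integral_const_mul, ← integral_add hdiff hsum]
  exact integral_mono_ae ((integrable_variance_path hV).sub (integrable_variance_path hW)).abs
    (hdiff.add hsum) hle

end

end Variance

section LaplaceContinuity

variable {Ω : Type*} [MeasurableSpace Ω] {P : Measure Ω}

lemma abs_exp_neg_sub_exp_neg_le {a b : ℝ} (ha : 0 ≤ a) (hb : 0 ≤ b) :
    |Real.exp (-a) - Real.exp (-b)| ≤ |a - b| := by
  wlog hab : a ≤ b generalizing a b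
  · rw [abs_sub_comm, abs_sub_comm a]
    exact this hb ha (not_le.1 hab).le
  rw [abs_of_nonneg (by simpa using hab), abs_of_nonpos (sub_nonpos.2 hab)]
  have hfactor : Real.exp (-b) = Real.exp (-a) * Real.exp (a - b) := by
    rw [← Real.exp_add]
    congr 1
    ring
  nlinarith [Real.add_one_le_exp (a - b), Real.exp_pos (-a),
    Real.exp_le_one_iff.2 (neg_nonpos.2 ha)]

lemma integrable_exp_neg [IsFiniteMeasure P] {X : Ω → ℝ} (hX : Integrable X P) (hX₀ : 0 ≤ X) :
    Integrable (fun ω => Real.exp (-X ω)) P := by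
  refine (integrable_const 1).mono'
    (Real.continuous_exp.comp_aestronglyMeasurable hX.aestronglyMeasurable.neg)
    (Eventually.of_forall fun ω => ?_)
  simpa using hX₀ ω

lemma tendsto_integral_exp_neg [IsFiniteMeasure P] {ι : Type*} {l : Filter ι} {X : ι → Ω → ℝ}
    {Y : Ω → ℝ} (hX : ∀ i, Integrable (X i) P) (hX₀ : ∀ i, 0 ≤ X i) (hY : Integrable Y P)
    (hY₀ : 0 ≤ Y) (h : Tendsto (fun i => ∫ ω, |X i ω - Y ω| ∂P) l (𝓝 0)) :
    Tendsto (fun i => ∫ ω, Real.exp (-X i ω) ∂P) l (𝓝 (∫ ω, Real.exp (-Y ω) ∂P)) := by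
  rw [tendsto_iff_dist_tendsto_zero]
  refine squeeze_zero (fun _ => dist_nonneg) (fun i => ?_) h
  rw [dist_eq_norm, ← integral_sub (integrable_exp_neg (hX i) (hX₀ i)) (integrable_exp_neg hY hY₀)]
  exact norm_integral_le_of_norm_le ((hX i).sub hY).abs
    (Eventually.of_forall fun ω => abs_exp_neg_sub_exp_neg_le (hX₀ i ω) (hY₀ ω))

end LaplaceContinuity

section StepFunctions

open Matrix

lemma intervalIntegral_comp_natFloor (φ : ℕ → ℝ) (n : ℕ) :
    ∫ t in (0 : ℝ)..n, φ ⌊t⌋₊ = ∑ k ∈ Finset.range n, φ k := by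
  have hstep (k : ℕ) : Set.EqOn (fun _ => φ k) (fun t : ℝ => φ ⌊t⌋₊)
      (Set.uIoo (k : ℝ) (k + 1 : ℕ)) := by
    rw [Set.uIoo_of_le (by simp), Nat.cast_succ]
    intro t ht
    exact congrArg φ (Nat.floor_eq_on_Ico k t (Set.Ioo_subset_Ico_self ht)).symm
  rw [← Nat.cast_zero, ← intervalIntegral.sum_integral_adjacent_intervals fun k _ =>
    intervalIntegrable_const.congr_uIoo (hstep k)]
  refine Finset.sum_congr rfl fun k _ => ?_
  rw [← intervalIntegral.integral_congr_uIoo (hstep k)]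
  simp

lemma integral_comp_natFloor_mul (φ : ℕ → ℝ) {n : ℕ} (hn : n ≠ 0) :
    ∫ t : I, φ ⌊(n : ℝ) * t⌋₊ = (n : ℝ)⁻¹ * ∑ k ∈ Finset.range n, φ k := by
  calc ∫ t : I, φ ⌊(n : ℝ) * t⌋₊
      = ∫ t in (0 : ℝ)..1, φ ⌊(n : ℝ) * t⌋₊ := by
        rw [intervalIntegral.integral_of_le zero_le_one, ← integral_Icc_eq_integral_Ioc]
        exact integral_subtype_comap measurableSet_Icc fun t : ℝ => φ ⌊(n : ℝ) * t⌋₊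
    _ = (n : ℝ)⁻¹ * ∑ k ∈ Finset.range n, φ k := by
        rw [intervalIntegral.integral_comp_mul_left (fun t => φ ⌊t⌋₊) (Nat.cast_ne_zero.2 hn),
          mul_zero, mul_one, intervalIntegral_comp_natFloor, smul_eq_mul]

lemma natFloor_mul_le (n : ℕ) (t : I) : ⌊(n : ℝ) * t⌋₊ ≤ n :=
  Nat.floor_le_of_le (mul_le_of_le_one_right n.cast_nonneg t.2.2)

lemma memLp_comp_natFloor_mul (φ : ℕ → ℝ) (n : ℕ) (p : ENNReal) :
    MemLp (fun t : I => φ ⌊(n : ℝ) * t⌋₊) p := by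
  refine MemLp.of_bound ((measurable_from_top (f := φ)).comp
    (by fun_prop : Measurable fun t : I => ⌊(n : ℝ) * t⌋₊)).aestronglyMeasurable
    (∑ k ∈ Finset.range (n + 1), |φ k|) (Eventually.of_forall fun t => ?_)
  exact Finset.single_le_sum (f := fun k => |φ k|) (fun _ _ => abs_nonneg _)
    (Finset.mem_range_succ_iff.2 (natFloor_mul_le n t))

lemma variance_comp_natFloor_mul (φ : ℕ → ℝ) {n : ℕ} (hn : n ≠ 0) :
    Var[fun t : I => φ ⌊(n : ℝ) * t⌋₊; volume] =
      (n : ℝ)⁻¹ * ((fun i : Fin n => φ i) ⬝ᵥ centering (Fin n) *ᵥ fun i : Fin n => φ i) := by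
  rw [variance_eq_sub (memLp_comp_natFloor_mul φ n 2), dotProduct_centering_mulVec,
    Fintype.card_fin, Fin.sum_univ_eq_sum_range, Fin.sum_univ_eq_sum_range fun k => φ k ^ 2]
  simp only [Pi.pow_apply]
  rw [integral_comp_natFloor_mul (fun k => φ k ^ 2) hn, integral_comp_natFloor_mul φ hn]
  ring

/-- The point `k / n` of the unit interval; the projection is the identity for `k ≤ n`. -/
noncomputable def grid (n k : ℕ) : I := Set.projIcc 0 1 zero_le_one ((k : ℝ) / n)

lemma coe_grid {n k : ℕ} (hk : k ≤ n) : (grid n k : ℝ) = k / n := by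
  rw [grid, Set.projIcc_of_mem zero_le_one (x := (k : ℝ) / n)]
  exact ⟨by positivity, div_le_one_of_le₀ (Nat.cast_le.2 hk) n.cast_nonneg⟩

lemma abs_sub_grid_natFloor_le {n : ℕ} (hn : n ≠ 0) (t : I) :
    |(t : ℝ) - grid n ⌊(n : ℝ) * t⌋₊| ≤ (n : ℝ)⁻¹ := by
  have hn₀ : (0 : ℝ) < n := by positivity
  have hscale : (t : ℝ) - ⌊(n : ℝ) * t⌋₊ / n = (n * t - ⌊(n : ℝ) * t⌋₊) / n := by field_simp
  have hle := Nat.floor_le (mul_nonneg hn₀.le t.2.1)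
  rw [coe_grid (natFloor_mul_le n t), hscale, abs_of_nonneg (div_nonneg (sub_nonneg.2 hle) hn₀.le),
    inv_eq_one_div]
  gcongr
  linarith [Nat.lt_floor_add_one ((n : ℝ) * t)]

lemma natCast_dist (i j : ℕ) : (Nat.dist i j : ℝ) = |(i : ℝ) - j| := by
  rcases le_total i j with h | h
  · rw [Nat.dist_eq_sub_of_le h, Nat.cast_sub h, abs_sub_comm,
      abs_of_nonneg (sub_nonneg.2 (Nat.cast_le.2 h))]
  · rw [Nat.dist_eq_sub_of_le_right h, Nat.cast_sub h,
      abs_of_nonneg (sub_nonneg.2 (Nat.cast_le.2 h))]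

variable {Ω : Type*} [MeasurableSpace Ω] {P : Measure Ω} {V : I → Ω → ℝ}

/-- The step process which equals `V (k / n)` on `[k / n, (k + 1) / n)`. -/
noncomputable def sampled (V : I → Ω → ℝ) (n : ℕ) : I → Ω → ℝ :=
  fun t => V (grid n ⌊(n : ℝ) * t⌋₊)

lemma aemeasurable_uncurry_sampled (hV : ∀ t, AEMeasurable (V t) P) (n : ℕ) :
    AEMeasurable (Function.uncurry (sampled V n)) ((volume : Measure I).prod P) := by
  have hmk : Measurable fun q : ℕ × Ω => (hV (grid n q.1)).mk (V (grid n q.1)) q.2 :=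
    measurable_from_prod_countable_right fun k => (hV (grid n k)).measurable_mk
  refine ⟨_, hmk.comp (by fun_prop : Measurable fun q : I × Ω => (⌊(n : ℝ) * q.1⌋₊, q.2)), ?_⟩
  have hae : ∀ᵐ q ∂(volume : Measure I).prod P, ∀ k,
      V (grid n k) q.2 = (hV (grid n k)).mk (V (grid n k)) q.2 :=
    Measure.quasiMeasurePreserving_snd.ae (ae_all_iff.2 fun k => (hV (grid n k)).ae_eq_mk)
  filter_upwards [hae] with q hq
  exact hq _

end StepFunctions

lemma hasGaussianLaw_comp {T Ω E ι : Type*} [MeasurableSpace Ω] {P : Measure Ω}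
    [NormedAddCommGroup E] [NormedSpace ℝ E] [MeasurableSpace E] [BorelSpace E]
    [SecondCountableTopology E] [Finite ι] {X : T → Ω → E} (hX : IsGaussianProcess X P)
    (t : ι → T) : HasGaussianLaw (fun ω i => X (t i) ω) P := by
  classical
  have := Fintype.ofFinite ι
  let reindex : (Finset.univ.image t → E) →L[ℝ] ι → E := ContinuousLinearMap.pi fun i =>
    ContinuousLinearMap.proj ⟨t i, Finset.mem_image_of_mem t (Finset.mem_univ i)⟩
  exact (hX.hasGaussianLaw (Finset.univ.image t)).map reindex

section

variable {Ω : Type*} {X : I → Ω → ℝ} {ω : Ω}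

lemma sq_pathNorm_demeaned (hX : MemLp (fun t => X t ω) 2) :
    pathNorm (demeaned X) ω ^ 2 = ENNReal.ofReal Var[fun t => X t ω; volume] := by
  have hsq := eLpNorm_nnreal_pow_eq_lintegral (μ := (volume : Measure I)) (p := 2)
    (f := fun t => demeaned X t ω) two_ne_zero
  simp only [NNReal.coe_ofNat, ENNReal.coe_ofNat, ENNReal.rpow_ofNat] at hsq
  rw [ofReal_variance hX, pathNorm]
  exact hsq

lemma pathNorm_demeaned_le_ofReal_iff (hX : MemLp (fun t => X t ω) 2) {ε : ℝ} (hε : 0 ≤ ε) :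
    pathNorm (demeaned X) ω ≤ ENNReal.ofReal ε ↔ Var[fun t => X t ω; volume] ≤ ε ^ 2 := by
  rw [← ENNReal.pow_le_pow_left_iff two_ne_zero, sq_pathNorm_demeaned hX, ← ENNReal.ofReal_pow hε,
    ENNReal.ofReal_le_ofReal_iff (sq_nonneg ε)]

end

section OrnsteinUhlenbeck

open Matrix

variable {Ω : Type*} [MeasurableSpace Ω] {P : Measure Ω} {β : ℝ} {U : I → Ω → ℝ}

namespace IsOrnsteinUhlenbeck

lemma memLp_two (hU : IsOrnsteinUhlenbeck β U P) (t : I) : MemLp (U t) 2 P :=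
  (hU.isGaussianProcess.hasGaussianLaw_eval t).memLp_two

lemma integral_sq (hU : IsOrnsteinUhlenbeck β U P) (t : I) :
    ∫ ω, U t ω ^ 2 ∂P = 1 / (2 * β) := by
  simpa [sq] using hU.covariance t t

lemma integral_sub_sq_le (hU : IsOrnsteinUhlenbeck β U P) (hβ : 0 < β) (t s : I) :
    ∫ ω, (U t ω - U s ω) ^ 2 ∂P ≤ |(t : ℝ) - s| := by
  have hcross : Integrable (fun ω => 2 * U t ω * U s ω) P :=
    ((hU.memLp_two t).const_mul 2).integrable_mul (hU.memLp_two s)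
  have hsq_sub : Integrable (fun ω => U t ω ^ 2 - 2 * U t ω * U s ω) P :=
    (hU.memLp_two t).integrable_sq.sub hcross
  have hcross_eq : ∫ ω, 2 * U t ω * U s ω ∂P = 1 / β * Real.exp (-β * |(t : ℝ) - s|) := by
    simp_rw [mul_assoc]
    rw [integral_const_mul, hU.covariance]
    field_simp
  calc ∫ ω, (U t ω - U s ω) ^ 2 ∂P
      = (1 - Real.exp (-β * |(t : ℝ) - s|)) / β := by
        simp_rw [sub_sq]
        rw [integral_add hsq_sub (hU.memLp_two s).integrable_sq,
          integral_sub (hU.memLp_two t).integrable_sq hcross, hcross_eq, hU.integral_sq,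
          hU.integral_sq]
        field_simp
        ring
    _ ≤ |(t : ℝ) - s| := by
        rw [div_le_iff₀ hβ]
        linarith [Real.add_one_le_exp (-β * |(t : ℝ) - s|)]

lemma integral_grid_mul_grid (hU : IsOrnsteinUhlenbeck β U P) {n : ℕ} (i j : Fin n) :
    ∫ ω, U (grid n i) ω * U (grid n j) ω ∂P =
      ((1 / (2 * β)) • arCorrelation (Real.exp (-β / n)) n) i j := by
  rw [hU.covariance, coe_grid i.2.le, coe_grid j.2.le, ← sub_div, abs_div, Nat.abs_cast,
    ← natCast_dist, Matrix.smul_apply, arCorrelation, of_apply, smul_eq_mul, ← Real.exp_nat_mul]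
  congr 2
  ring

lemma memLp_two_uncurry [IsProbabilityMeasure P] (hU : IsOrnsteinUhlenbeck β U P) :
    MemLp (Function.uncurry U) 2 ((volume : Measure I).prod P) :=
  _root_.memLp_two_uncurry hU.aemeasurable_uncurry hU.memLp_two fun t => (hU.integral_sq t).le

lemma memLp_two_uncurry_sampled [IsProbabilityMeasure P] (hU : IsOrnsteinUhlenbeck β U P)
    (n : ℕ) : MemLp (Function.uncurry (sampled U n)) 2 ((volume : Measure I).prod P) :=
  _root_.memLp_two_uncurry
    (aemeasurable_uncurry_sampled (fun t => hU.isGaussianProcess.aemeasurable t) n)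
    (fun _ => hU.memLp_two _) fun _ => (hU.integral_sq _).le

lemma integral_abs_variance_sub_variance_sampled_le [IsProbabilityMeasure P]
    (hU : IsOrnsteinUhlenbeck β U P) (hβ : 0 < β) {n : ℕ} (hn : n ≠ 0) :
    ∫ ω, |Var[fun t => U t ω; volume] - Var[fun t => sampled U n t ω; volume]| ∂P ≤
      (1 / 2 + 1 / β) * (√n)⁻¹ := by
  have hn₀ : (0 : ℝ) < n := by positivity
  have hU₂ := hU.memLp_two_uncurry
  have hS₂ := hU.memLp_two_uncurry_sampled n
  have hdiff : ∫ t, ∫ ω, (U t ω - sampled U n t ω) ^ 2 ∂P ≤ (n : ℝ)⁻¹ := by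
    refine (integral_mono (hU₂.sub hS₂).integrable_sq.integral_prod_left
      (integrable_const (n : ℝ)⁻¹) fun t => ?_).trans (by simp)
    exact (hU.integral_sub_sq_le hβ t _).trans (abs_sub_grid_natFloor_le hn t)
  have hsq : ∫ t, ∫ ω, U t ω ^ 2 ∂P = 1 / (2 * β) := by simp [hU.integral_sq]
  have hsq_sampled : ∫ t, ∫ ω, sampled U n t ω ^ 2 ∂P = 1 / (2 * β) := by
    simp [sampled, hU.integral_sq]
  calc ∫ ω, |Var[fun t => U t ω; volume] - Var[fun t => sampled U n t ω; volume]| ∂P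
      ≤ √n / 2 * (∫ t, ∫ ω, (U t ω - sampled U n t ω) ^ 2 ∂P) +
          (√n)⁻¹ * ((∫ t, ∫ ω, U t ω ^ 2 ∂P) + ∫ t, ∫ ω, sampled U n t ω ^ 2 ∂P) :=
        integral_abs_variance_path_sub_le hU₂ hS₂ (Real.sqrt_pos.2 hn₀)
    _ ≤ √n / 2 * (n : ℝ)⁻¹ + (√n)⁻¹ * (1 / (2 * β) + 1 / (2 * β)) := by
        rw [hsq, hsq_sampled]
        gcongr
    _ = (1 / 2 + 1 / β) * (√n)⁻¹ := by
        rw [div_mul_eq_mul_div, ← div_eq_mul_inv, Real.sqrt_div_self']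
        field_simp
        ring

lemma sq_integral_exp_neg_variance_sampled (hU : IsOrnsteinUhlenbeck β U P) (hβ : 0 < β) {n : ℕ}
    (hn : n ≠ 0) {κ : ℝ} (hκ : 0 ≤ κ) :
    (∫ ω, Real.exp (-(n * κ * β * Var[fun t => sampled U n t ω; volume])) ∂P) ^ 2 *
      (1 + centering (Fin n) * κ • arCorrelation (Real.exp (-β / n)) n).det = 1 := by
  have hM : ((κ * β) • centering (Fin n)).PosSemidef :=
    posSemidef_centering.smul (by positivity)
  have hdet := sq_integral_exp_neg_quadForm
    (hasGaussianLaw_comp hU.isGaussianProcess fun i : Fin n => grid n i)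
    (fun i => hU.mean_zero _) hU.integral_grid_mul_grid hM
  have hprod : (2 : ℝ) • ((κ * β) • centering (Fin n) *
      (1 / (2 * β)) • arCorrelation (Real.exp (-β / n)) n) =
      centering (Fin n) * κ • arCorrelation (Real.exp (-β / n)) n := by
    rw [Matrix.smul_mul, Matrix.mul_smul, Matrix.mul_smul, smul_smul, smul_smul]
    congr 1
    field_simp
  have hform (ω : Ω) : n * κ * β * Var[fun t => sampled U n t ω; volume] =
      (fun i : Fin n => U (grid n i) ω) ⬝ᵥ ((κ * β) • centering (Fin n)) *ᵥ
        fun i : Fin n => U (grid n i) ω := by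
    have hvar : Var[fun t => sampled U n t ω; volume] = _ :=
      variance_comp_natFloor_mul (fun k => U (grid n k) ω) hn
    rw [smul_mulVec, dotProduct_smul, smul_eq_mul, hvar]
    field_simp
  simp_rw [hform]
  rwa [hprod] at hdet

lemma integral_abs_smul_variance_sampled_sub_le [IsProbabilityMeasure P]
    (hU : IsOrnsteinUhlenbeck β U P) (hβ : 0 < β) {n : ℕ} (hn : n ≠ 0) {a : ℝ} (ha : 0 ≤ a)
    (s : ℝ) :
    ∫ ω, |a * Var[fun t => sampled U n t ω; volume] - s * Var[fun t => U t ω; volume]| ∂P ≤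
      a * ((1 / 2 + 1 / β) * (√n)⁻¹) + |a - s| * ∫ ω, Var[fun t => U t ω; volume] ∂P := by
  have hvar := integrable_variance_path hU.memLp_two_uncurry
  have hvar_sampled := integrable_variance_path (hU.memLp_two_uncurry_sampled n)
  have hdiff : Integrable (fun ω =>
      |Var[fun t => U t ω; volume] - Var[fun t => sampled U n t ω; volume]|) P :=
    (hvar.sub hvar_sampled).abs
  calc ∫ ω, |a * Var[fun t => sampled U n t ω; volume] - s * Var[fun t => U t ω; volume]| ∂P
      ≤ ∫ ω, (a * |Var[fun t => U t ω; volume] - Var[fun t => sampled U n t ω; volume]| +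
          |a - s| * Var[fun t => U t ω; volume]) ∂P := by
        refine integral_mono ((hvar_sampled.const_mul a).sub (hvar.const_mul s)).abs
          ((hdiff.const_mul a).add (hvar.const_mul _)) fun ω => ?_
        set S := Var[fun t => U t ω; volume] with hS
        set T := Var[fun t => sampled U n t ω; volume]
        have hsplit : a * T - s * S = a * (T - S) + (a - s) * S := by ring
        calc |a * T - s * S| ≤ |a * (T - S)| + |(a - s) * S| := hsplit ▸ abs_add_le _ _
          _ = a * |S - T| + |a - s| * S := by
            rw [abs_mul, abs_mul, abs_of_nonneg ha, abs_sub_comm, hS,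
              abs_of_nonneg (variance_nonneg _ _)]
    _ = a * ∫ ω, |Var[fun t => U t ω; volume] - Var[fun t => sampled U n t ω; volume]| ∂P +
          |a - s| * ∫ ω, Var[fun t => U t ω; volume] ∂P := by
        rw [integral_add (hdiff.const_mul a) (hvar.const_mul _), integral_const_mul,
          integral_const_mul]
    _ ≤ _ := by
        gcongr
        exact hU.integral_abs_variance_sub_variance_sampled_le hβ hn

lemma tendsto_integral_exp_neg_mul_variance_sampled [IsProbabilityMeasure P]
    (hU : IsOrnsteinUhlenbeck β U P) (hβ : 0 < β) {a : ℕ → ℝ} (ha₀ : 0 ≤ a) {s : ℝ}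
    (ha : Tendsto a atTop (𝓝 s)) :
    Tendsto (fun n => ∫ ω, Real.exp (-(a n * Var[fun t => sampled U n t ω; volume])) ∂P) atTop
      (𝓝 (∫ ω, Real.exp (-(s * Var[fun t => U t ω; volume])) ∂P)) := by
  have hs : 0 ≤ s := ge_of_tendsto' ha ha₀
  refine tendsto_integral_exp_neg
    (fun n => (integrable_variance_path (hU.memLp_two_uncurry_sampled n)).const_mul (a n))
    (fun n ω => mul_nonneg (ha₀ n) (variance_nonneg _ _))
    ((integrable_variance_path hU.memLp_two_uncurry).const_mul s)
    (fun ω => mul_nonneg hs (variance_nonneg _ _)) ?_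
  have hsqrt : Tendsto (fun n : ℕ => (√n)⁻¹) atTop (𝓝 0) :=
    tendsto_inv_atTop_zero.comp (Real.tendsto_sqrt_atTop.comp tendsto_natCast_atTop_atTop)
  have hbound : Tendsto (fun n => a n * ((1 / 2 + 1 / β) * (√n)⁻¹) +
      |a n - s| * ∫ ω, Var[fun t => U t ω; volume] ∂P) atTop (𝓝 0) := by
    simpa using (ha.mul (hsqrt.const_mul (1 / 2 + 1 / β))).add
      ((ha.sub_const s).abs.mul_const (∫ ω, Var[fun t => U t ω; volume] ∂P))
  refine squeeze_zero' (Eventually.of_forall fun n => integral_nonneg fun ω => abs_nonneg _) ?_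
    hbound
  filter_upwards [eventually_ne_atTop 0] with n hn
  exact hU.integral_abs_smul_variance_sampled_sub_le hβ hn (ha₀ n) s

theorem sq_integral_exp_neg_mul_variance [IsProbabilityMeasure P]
    (hU : IsOrnsteinUhlenbeck β U P) (hβ : 0 < β) {s : ℝ} (hs : 0 < s) :
    (∫ ω, Real.exp (-(s * Var[fun t => U t ω; volume])) ∂P) ^ 2 *
      fredholmDetReal β √(2 * s + β ^ 2) = 1 := by
  have hβγ : β < √(2 * s + β ^ 2) := Real.lt_sqrt_of_sq_lt (by linarith)
  have hweight₀ (n : ℕ) := gridWeight_nonneg hβ.le hβγ.le n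
  have hscale : Tendsto (fun n : ℕ => n * gridWeight β √(2 * s + β ^ 2) n * β) atTop (𝓝 s) := by
    convert (tendsto_nat_mul_gridWeight hβ.ne' √(2 * s + β ^ 2)).mul_const β using 2
    rw [Real.sq_sqrt (by positivity)]
    field_simp
    ring
  have hlaplace := hU.tendsto_integral_exp_neg_mul_variance_sampled hβ
    (fun n => mul_nonneg (mul_nonneg n.cast_nonneg (hweight₀ n)) hβ.le) hscale
  refine tendsto_nhds_unique
    ((hlaplace.pow 2).mul (tendsto_det_one_add_centering_mul hβ hβγ))
    (tendsto_const_nhds.congr' ?_)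
  filter_upwards [eventually_ne_atTop 0] with n hn
  exact (hU.sq_integral_exp_neg_variance_sampled hβ hn (hweight₀ n)).symm

lemma measureReal_pathNorm_demeaned_le [IsProbabilityMeasure P]
    (hU : IsOrnsteinUhlenbeck β U P) {ε : ℝ} (hε : 0 ≤ ε) :
    P.real {ω | pathNorm (demeaned U) ω ≤ ENNReal.ofReal ε} =
      cdf (P.map fun ω => Var[fun t => U t ω; volume]) (ε ^ 2) := by
  have hvar := (integrable_variance_path hU.memLp_two_uncurry).aemeasurable
  have := Measure.isProbabilityMeasure_map hvar
  rw [cdf_eq_real, map_measureReal_apply_of_aemeasurable hvar measurableSet_Iic]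
  refine measureReal_congr ?_
  filter_upwards [memLp_two_path hU.memLp_two_uncurry] with ω hω
  exact propext (pathNorm_demeaned_le_ofReal_iff hω hε)

theorem tendsto_cdf_variance_mul_exp [IsProbabilityMeasure P]
    (hU : IsOrnsteinUhlenbeck β U P) (hβ : 0 < β) :
    Tendsto (fun x => cdf (P.map fun ω => Var[fun t => U t ω; volume]) x *
      Real.exp (1 / 8 * x⁻¹)) (𝓝[>] 0)
      (𝓝 ((16 * Real.exp β / (Real.pi * (2 + β))) ^ (1 / 2 : ℝ))) := by
  have hvar := (integrable_variance_path hU.memLp_two_uncurry).aemeasurable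
  have := Measure.isProbabilityMeasure_map hvar
  have hconst : (16 * Real.exp β / (Real.pi * (2 + β))) ^ (1 / 2 : ℝ) =
      2 * √(4 * Real.exp β / (2 + β)) / √Real.pi := by
    rw [← Real.sqrt_eq_rpow, ← Real.sqrt_sq zero_le_two, ← Real.sqrt_mul (by positivity),
      ← Real.sqrt_div (by positivity), Real.sqrt_sq zero_le_two]
    congr 1
    field_simp
    ring
  rw [hconst]
  refine tendsto_cdf_mul_exp_of_sq_mul_fredholmDetReal ?_ (by linarith) fun s hs => ?_
  · rw [ae_map_iff hvar measurableSet_Ici]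
    exact Eventually.of_forall fun ω => variance_nonneg _ _
  · rw [mgf_id_map hvar]
    simpa only [mgf, neg_mul] using hU.sq_integral_exp_neg_mul_variance hβ hs

end IsOrnsteinUhlenbeck

end OrnsteinUhlenbeck

theorem mainTheorem4 {Ω : Type*} [MeasurableSpace Ω] (P : Measure Ω) [IsProbabilityMeasure P]
    (β : ℝ) (hβ : 0 < β) (U : I → Ω → ℝ) (hU : IsOrnsteinUhlenbeck β U P) :
    (fun ε : ℝ => P.real {ω | pathNorm (demeaned U) ω ≤ ENNReal.ofReal ε})
      ~[𝓝[>] (0 : ℝ)]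
    (fun ε : ℝ => (16 * Real.exp β / (Real.pi * (2 + β))) ^ (1 / 2 : ℝ) *
      Real.exp (-(1 / 8) * (ε ^ 2)⁻¹)) := by
  set c := (16 * Real.exp β / (Real.pi * (2 + β))) ^ (1 / 2 : ℝ) with hc
  have hc₀ : c ≠ 0 := (Real.rpow_pos_of_pos (by positivity) _).ne'
  have hsq : Tendsto (fun ε : ℝ => ε ^ 2) (𝓝[>] 0) (𝓝[>] 0) :=
    tendsto_nhdsWithin_iff.2 ⟨((continuous_pow 2).tendsto' 0 0 (by simp)).mono_left
      nhdsWithin_le_nhds, eventually_mem_nhdsWithin.mono fun ε hε => pow_pos (Set.mem_Ioi.1 hε) 2⟩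
  have hlim := ((hU.tendsto_cdf_variance_mul_exp hβ).comp hsq).div_const c
  rw [← hc, div_self hc₀] at hlim
  refine (isEquivalent_iff_tendsto_one (Eventually.of_forall fun ε => by positivity)).2
    (hlim.congr' ?_)
  filter_upwards [self_mem_nhdsWithin] with ε hε
  rw [Pi.div_apply, hU.measureReal_pathNorm_demeaned_le (le_of_lt hε), neg_mul, Real.exp_neg]
  simp only [Function.comp_apply]
  field_simp
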